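/- Let $f$ be a (Borel measurable, nonnegative) probability density on $(0,1)$, let $X_1, X_2, \dots$ be independent random variables with common density $f$, and let $N$ be independent of them and Poisson distributed with mean $\lambda$. The (almost surely distinct) keys $X_1, \dots, X_N$ are sorted by Quicksort: a list of at most one key needs no work; otherwise a pivot is chosen uniformly at random from the list, every other key is compared with it, and the keys smaller than the pivot and those larger than the pivot are sorted recursively in the same way. Comparing two distinct keys $x, y$ costs $b(x,y)$ bit comparisons, where $b(x,y) \ge 1$ is the index of the first bit at which the binary expansions of $x$ and $y$ differ (terminating expansions being used for dyadic rationals). Let $\mu_f(\lambda) \in [0,\infty]$ be the expected total number of bit comparisons, over the keys, $N$ and the pivot choices, and let $\mu_{\mathrm{unif}}(\lambda)$ be this expectation for uniformly distributed keys ($f \equiv 1$). Write $\ln$ and $\lg$ for the natural and binary logarithm, $\ln_+ = \max(0, \ln)$, and $0 \lg 0 = 0$. (a) For every $\lambda \ge 0$, $\mu_f(\lambda) \ge \mu_{\mathrm{unif}}(\lambda)$. (b) If $\int_0^1 f\,(\ln_+ f)^4 < \infty$, then $f \lg f$ is integrable on $(0,1)$, the entropy in bits $H(f) := \int_0^1 f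 \lg f$ satisfies $H(f) \ge 0$, both $\mu_f(\lambda)$ and $\mu_{\mathrm{unif}}(\lambda)$ are finite for every $\lambda \ge 0$, and, as $\lambda \to \infty$, $$\mu_f(\lambda) = \mu_{\mathrm{unif}}(\lambda) + 2 H(f)\, \lambda \ln \lambda + o(\lambda \log \lambda).$$ -/

import Mathlib

open MeasureTheory ProbabilityTheory Filter Asymptotics Set
open scoped ENNReal NNReal

/-- The cost `b(x, y)` of comparing two distinct keys `x, y ∈ (0, 1)` bit by bit: the index
(counted from `1`) of the first bit at which their binary expansions differ. `Real.digits x 2 k`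
is the `(k + 1)`st binary digit of `x`, in the terminating expansion if `x` is a dyadic rational. -/
noncomputable def bitCost (x y : ℝ) : ℕ :=
  sInf {k : ℕ | Real.digits x 2 k ≠ Real.digits y 2 k} + 1

/-- Quicksort with uniformly random pivots, as a randomized algorithm acting on a list of keys.
The result is the joint law of the returned list and of the total number of bit comparisons made.
A list with at most one key is returned as it is. Otherwise a pivot is chosen uniformly at random,
every other key is compared with it, and the keys smaller than the pivot and the remaining keys
are sorted recursively, with independent random choices. -/
noncomputable def quicksort (l : List ℝ) : PMF (List ℝ × ℕ) :=
  if h : l.length ≤ 1 then PMF.pure (l, 0)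
  else
    haveI : Nonempty (Fin l.length) := ⟨⟨0, by omega⟩⟩
    (PMF.uniformOfFintype (Fin l.length)).bind fun i =>
      (quicksort ((l.eraseIdx i).filter fun x => x < l.get i)).bind fun L =>
        (quicksort ((l.eraseIdx i).filter fun x => ¬ x < l.get i)).bind fun R =>
          PMF.pure (L.1 ++ l.get i :: R.1,
            ((l.eraseIdx i).map fun x => bitCost x (l.get i)).sum + L.2 + R.2)
termination_by l.length
decreasing_by
  all_goals
    refine lt_of_le_of_lt (List.length_filter_le _ _) ?_
    have := i.isLt
    rw [List.length_eraseIdx_of_lt i.isLt]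
    omega

/-- The expected number of bit comparisons made by Quicksort on a given list of keys; the
expectation is over the choices of the pivots. -/
noncomputable def expectedBits (l : List ℝ) : ℝ≥0∞ :=
  ∑' r : List ℝ × ℕ, quicksort l r * (r.2 : ℝ≥0∞)

/-- The expected number of bit comparisons made by Quicksort on the keys `X 0, …, X (N - 1)`, where
`X 0, X 1, …` are independent with common distribution `F`, and `N` is Poisson distributed
with mean `lam`, independently of the keys. -/
noncomputable def meanBits (F : Measure ℝ) (lam : ℝ≥0) : ℝ≥0∞ :=
  ∫⁻ ω : (ℕ → ℝ) × ℕ, expectedBits ((List.range ω.2).map ω.1)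
    ∂((Measure.infinitePi fun _ : ℕ => F).prod (poissonMeasure lam))

/-- The uniform distribution on `(0, 1)`. -/
noncomputable def unifDist : Measure ℝ := volume.restrict (Ioo 0 1)

/-- The distribution over `(0, 1)` with density `f`. -/
noncomputable def densityDist (f : ℝ → ℝ) : Measure ℝ :=
  unifDist.withDensity fun x => ENNReal.ofReal (f x)

/-- The entropy in bits, `H(f) = ∫₀¹ f lg f`, of a density `f` on `(0, 1)`, with `0 lg 0 = 0`. -/
noncomputable def entropyBits (f : ℝ → ℝ) : ℝ :=
  ∫ x in Ioo 0 1, f x * Real.logb 2 (f x)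

/-! Two keys agree in their first k bits exactly when they lie in the same dyadic cell of rank k, so
b(x, y) is the number of ranks k ≥ 0 at which x and y share a cell. A cell is an interval: a pivot
outside it leaves its keys together, and a pivot inside it is uniform among its keys. Hence
comparisons within one cell are those of a separate Quicksort on its keys, and the mean cost of a
list is the sum of `meanComparisons` over all cells (`expectedBits_eq_cellSum`).

With a Poisson number of keys, a cell of mass p holds a Poisson number of mean λp. So μ_f(λ) = ∑_k
∑_j P(λ p_kj), where P = `poissonComparisons` is an explicit integral of functions convex in t,
hence convex. Everything else is convexity together with the growth of r(t) = P(t)/t and of R(t) =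
∑_k r(t/2^k), which are `comparisonRate` and `bitRate`. For uniform keys μ_unif(λ) = λ R(λ).

Part (a) is convexity: at each rank, equal masses minimize the sum (`le_levelComparisons`).

For (b), r(t) - r(s) is close to 2 ln(t/s) for large s ≤ t, and about lg t ranks matter, so R(ux) -
R(x) = 2 lg u · ln x + O_u(1). For the upper bound, Jensen inside each cell gives μ_f(λ) ≤ ∫ λf
R(λf); dominated convergence for f (R(fλ) - R(λ)) / ln λ then produces 2H(f). For the lower bound, a
fixed K is chosen, ranks below K are bounded by the uniform value, and at later ranks the keys are
spread evenly within the cells of rank K. This yields twice the entropy of f averaged over cells of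
rank K (`cellEntropy`). Lebesgue differentiation and Fatou show that these entropies exceed every c
< H(f) for some K. Finally H(f) ≥ 0 follows from (a) and the limit. -/

open scoped Finset

/-! ### Binary digits and dyadic cells -/

/-- The dyadic cell of rank `k` that contains `x ∈ [0, 1)`, as an index in `[0, 2 ^ k)`. -/
noncomputable def dyadicIndex (k : ℕ) (x : ℝ) : ℕ := ⌊2 ^ k * x⌋₊

theorem dyadicIndex_lt {x : ℝ} (hx : x ∈ Ico (0 : ℝ) 1) (k : ℕ) : dyadicIndex k x < 2 ^ k := by
  rw [dyadicIndex, Nat.floor_lt (by have := hx.1; positivity)]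
  push_cast
  have := hx.2
  have h2 : (0 : ℝ) < 2 ^ k := by positivity
  nlinarith

theorem dyadicIndex_succ_div (k : ℕ) (x : ℝ) : dyadicIndex (k + 1) x / 2 = dyadicIndex k x := by
  rw [dyadicIndex, dyadicIndex, ← Nat.floor_div_ofNat]
  congr 1
  rw [pow_succ]
  ring

theorem dyadicIndex_eq_of_le {x y : ℝ} {k l : ℕ} (hkl : k ≤ l)
    (h : dyadicIndex l x = dyadicIndex l y) : dyadicIndex k x = dyadicIndex k y := by
  induction l, hkl using Nat.le_induction with
  | base => exact h
  | succ l _ ih => exact ih (by rw [← dyadicIndex_succ_div, h, dyadicIndex_succ_div])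

/-- The index of the cell of rank k is the integer spelled by the first k binary digits. -/
theorem dyadicIndex_eq_iff_digits_eq {x y : ℝ} (hx : x ∈ Ico (0 : ℝ) 1) (hy : y ∈ Ico (0 : ℝ) 1)
    (k : ℕ) : dyadicIndex k x = dyadicIndex k y ↔
      ∀ i < k, Real.digits x 2 i = Real.digits y 2 i := by
  constructor
  · intro h i hi
    have h1 : dyadicIndex (i + 1) x = dyadicIndex (i + 1) y := dyadicIndex_eq_of_le hi h
    rw [dyadicIndex, dyadicIndex, mul_comm, mul_comm _ y] at h1
    simp only [Real.digits, Nat.cast_ofNat, h1]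
  · intro h
    have h1 := Real.ofDigits_digits_sum_eq (b := 2) hx k
    have h2 := Real.ofDigits_digits_sum_eq (b := 2) hy k
    have h3 : ∑ i ∈ Finset.range k, Real.ofDigitsTerm (Real.digits x 2) i =
        ∑ i ∈ Finset.range k, Real.ofDigitsTerm (Real.digits y 2) i := by
      refine Finset.sum_congr rfl fun i hi => ?_
      simp only [Real.ofDigitsTerm, h i (Finset.mem_range.1 hi)]
    rw [h3, h2] at h1
    simpa [dyadicIndex] using (Nat.cast_injective h1).symm

/-- Bit k + 1 is inspected exactly when the first k bits agree. The term k = 0 is always 1 and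
accounts for the `+ 1` in `bitCost`. -/
theorem bitCost_eq_tsum {x y : ℝ} (hx : x ∈ Ico (0 : ℝ) 1) (hy : y ∈ Ico (0 : ℝ) 1)
    (hxy : x ≠ y) :
    (bitCost x y : ℝ≥0∞) = ∑' k, if dyadicIndex k x = dyadicIndex k y then 1 else 0 := by
  -- Since x ≠ y, some digit differs, so `sInf` is attained and is not the default value 0 of the
  -- empty set.
  have hne : {k : ℕ | Real.digits x 2 k ≠ Real.digits y 2 k}.Nonempty := by
    by_contra hcon
    refine hxy ?_
    have : Real.digits x 2 = Real.digits y 2 := by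
      funext k
      by_contra hk
      exact hcon ⟨k, hk⟩
    rw [← Real.ofDigits_digits (b := 2) (by norm_num) hx, this,
      Real.ofDigits_digits (by norm_num) hy]
  have key : ∀ k, dyadicIndex k x = dyadicIndex k y ↔ k ∈ Finset.range (bitCost x y) := by
    intro k
    rw [dyadicIndex_eq_iff_digits_eq hx hy, Finset.mem_range, bitCost, Nat.lt_succ_iff]
    constructor
    · intro h
      by_contra! hlt
      exact Nat.sInf_mem hne (h _ hlt)
    · intro h i hi
      by_contra hcon
      exact Nat.notMem_of_lt_sInf (hi.trans_le h) hcon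
  simp_rw [key]
  rw [tsum_eq_sum (s := Finset.range (bitCost x y)) (by intro b hb; simp [hb]),
    Finset.sum_congr rfl fun k hk => if_pos hk]
  simp

/-! ### Key comparisons of Quicksort and their restriction to intervals -/

/-- The mean number of key comparisons made by Quicksort on `m` distinct keys. -/
noncomputable def meanComparisons (m : ℕ) : ℝ≥0 :=
  ∑ i ∈ Finset.range m, ∑ j ∈ Finset.range i, 2 / ((j : ℝ≥0) + 2)

@[simp] theorem meanComparisons_zero : meanComparisons 0 = 0 := by simp [meanComparisons]

@[simp] theorem meanComparisons_one : meanComparisons 1 = 0 := by simp [meanComparisons]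

theorem meanComparisons_of_le_one {m : ℕ} (hm : m ≤ 1) : meanComparisons m = 0 := by
  interval_cases m <;> simp

theorem meanComparisons_succ (m : ℕ) : meanComparisons (m + 1) =
    meanComparisons m + ∑ j ∈ Finset.range m, 2 / ((j : ℝ≥0) + 2) :=
  Finset.sum_range_succ _ _

/-- In the double sum, 2 / (j + 2) is the probability that two keys whose ranks differ by j + 1 are
compared. This closed form, written without truncated subtraction, drives the induction for the
recurrence `mul_meanComparisons`. -/
theorem meanComparisons_add_two_mul (m : ℕ) : meanComparisons m + 2 * m =
    (m + 1) * ∑ j ∈ Finset.range m, 2 / ((j : ℝ≥0) + 2) := by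
  induction m with
  | zero => simp
  | succ m ih =>
    rw [meanComparisons_succ, Finset.sum_range_succ]
    rw [← NNReal.coe_inj] at ih ⊢
    push_cast at ih ⊢
    have : (m : ℝ) + 2 ≠ 0 := by positivity
    field_simp
    linear_combination (m + 2 : ℝ) * ih

/-- The recurrence for the number of key comparisons. -/
theorem mul_meanComparisons (m : ℕ) : m * meanComparisons m =
    m * ((m - 1 : ℕ) : ℝ≥0) + 2 * ∑ j ∈ Finset.range m, meanComparisons j := by
  induction m with
  | zero => simp
  | succ m ih =>
    have h := meanComparisons_add_two_mul m
    have hm : (m : ℝ≥0) * ((m - 1 : ℕ) : ℝ≥0) + m = m * m := by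
      rcases m with _ | m
      · simp
      · rw [Nat.add_sub_cancel]
        push_cast
        ring
    rw [Finset.sum_range_succ, meanComparisons_succ, Nat.add_sub_cancel]
    generalize ((m - 1 : ℕ) : ℝ≥0) = r at ih hm
    rw [← NNReal.coe_inj] at ih h hm ⊢
    push_cast at ih h hm ⊢
    linear_combination ih - h + hm

/-- The number of smaller elements takes each value below `s.card` exactly once, so a uniform pivot
leaves a uniformly distributed number of smaller keys. Adding a new maximum does not change the
earlier ranks. -/
theorem sum_card_filter_lt {α M : Type*} [LinearOrder α] [AddCommMonoid M] (s : Finset α)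
    (F : ℕ → M) : ∑ x ∈ s, F #{y ∈ s | y < x} = ∑ j ∈ Finset.range s.card, F j := by
  classical
  induction s using Finset.induction_on_max with
  | empty => simp
  | insert a s ha ih =>
    have has : a ∉ s := fun h => lt_irrefl _ (ha a h)
    rw [Finset.sum_insert has, Finset.card_insert_of_notMem has, Finset.sum_range_succ, ← ih,
      add_comm]
    congr 1
    · refine Finset.sum_congr rfl fun x hx => ?_
      rw [Finset.filter_insert, if_neg (ha x hx).not_gt]
    · rw [Finset.filter_insert, if_neg (lt_irrefl a), Finset.filter_true_of_mem ha]

theorem sum_card_filter_gt {α M : Type*} [LinearOrder α] [AddCommMonoid M] (s : Finset α)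
    (F : ℕ → M) : ∑ x ∈ s, F #{y ∈ s | x < y} = ∑ j ∈ Finset.range s.card, F j :=
  sum_card_filter_lt (α := αᵒᵈ) s F

/-- The quicksort recurrence, restricted to the keys that lie in an order-convex set. -/
theorem card_mul_meanComparisons_filter {α : Type*} [LinearOrder α] (s : Finset α) (C : α → Prop)
    [DecidablePred C] (hC : ∀ x y z, x < y → y < z → C x → C z → C y) :
    s.card * meanComparisons #{y ∈ s | C y} =
      ∑ x ∈ s, ((#{y ∈ s.erase x | C x ∧ C y} : ℝ≥0) + meanComparisons #{y ∈ s | y < x ∧ C y} +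
        meanComparisons #{y ∈ s | x < y ∧ C y}) := by
  -- A pivot outside `C` has all of `C` on one side, by convexity: nothing is charged and the keys
  -- of `C` pass intact to one recursive call.
  have hout : ∀ x ∈ s.filter fun x => ¬ C x,
      (#{y ∈ s.erase x | C x ∧ C y} : ℝ≥0) + meanComparisons #{y ∈ s | y < x ∧ C y} +
        meanComparisons #{y ∈ s | x < y ∧ C y} = meanComparisons #{y ∈ s | C y} := by
    intro x hx
    obtain ⟨-, hx⟩ := Finset.mem_filter.1 hx
    have h0 : #{y ∈ s.erase x | C x ∧ C y} = 0 := by simp [hx]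
    by_cases hlo : ∃ z ∈ s, z < x ∧ C z
    · obtain ⟨z, -, hzx, hz⟩ := hlo
      have h1 : {y ∈ s | y < x ∧ C y} = {y ∈ s | C y} := by
        refine Finset.filter_congr fun y _ => ⟨fun h => h.2, fun h => ⟨?_, h⟩⟩
        by_contra! hxy
        rcases hxy.eq_or_lt with rfl | hlt
        · exact hx h
        · exact hx (hC _ _ _ hzx hlt hz h)
      have h2 : {y ∈ s | x < y ∧ C y} = ∅ :=
        Finset.filter_eq_empty_iff.2 fun y _ h => hx (hC _ _ _ hzx h.1 hz h.2)
      simp [h0, h1, h2]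
    · push Not at hlo
      have h1 : {y ∈ s | y < x ∧ C y} = ∅ :=
        Finset.filter_eq_empty_iff.2 fun y hy h => hlo y hy h.1 h.2
      have h2 : {y ∈ s | x < y ∧ C y} = {y ∈ s | C y} := by
        refine Finset.filter_congr fun y hy => ⟨fun h => h.2, fun h => ⟨?_, h⟩⟩
        by_contra! hxy
        rcases hxy.eq_or_lt with rfl | hlt
        · exact hx h
        · exact hlo y hy hlt h
      simp [h0, h1, h2]
  -- A pivot inside `C` acts as a pivot of Quicksort run on the keys of `C` alone.
  have hin : ∀ x ∈ s.filter C,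
      (#{y ∈ s.erase x | C x ∧ C y} : ℝ≥0) + meanComparisons #{y ∈ s | y < x ∧ C y} +
        meanComparisons #{y ∈ s | x < y ∧ C y} =
      ((#{y ∈ s | C y} - 1 : ℕ) : ℝ≥0) + meanComparisons #{y ∈ s.filter C | y < x} +
        meanComparisons #{y ∈ s.filter C | x < y} := by
    intro x hx
    obtain ⟨hxs, hCx⟩ := Finset.mem_filter.1 hx
    have h0 : #{y ∈ s.erase x | C x ∧ C y} = #{y ∈ s | C y} - 1 := by
      simp only [hCx, true_and]
      rw [Finset.filter_erase, Finset.card_erase_of_mem hx]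
    rw [h0, Finset.filter_filter, Finset.filter_filter]
    simp only [and_comm]
  rw [← Finset.sum_filter_add_sum_filter_not s C, Finset.sum_congr rfl hout,
    Finset.sum_congr rfl hin, Finset.sum_add_distrib, Finset.sum_add_distrib,
    sum_card_filter_lt, sum_card_filter_gt, Finset.sum_const, Finset.sum_const, nsmul_eq_mul,
    nsmul_eq_mul, ← Finset.card_filter_add_card_filter_not (s := s) C, Nat.cast_add, add_mul,
    mul_meanComparisons]
  ring

/-! ### The cost of a fixed list as a sum over dyadic cells -/

theorem PMF.tsum_bind_mul {α β : Type*} (p : PMF α) (f : α → PMF β) (c : β → ℝ≥0∞) :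
    ∑' b, (p.bind f) b * c b = ∑' a, p a * ∑' b, f a b * c b := by
  simp_rw [PMF.bind_apply, ← ENNReal.tsum_mul_right, ← ENNReal.tsum_mul_left]
  rw [ENNReal.tsum_comm]
  simp_rw [mul_assoc]

theorem PMF.tsum_pure_mul {α : Type*} (a : α) (c : α → ℝ≥0∞) :
    ∑' b, PMF.pure a b * c b = c a := by
  classical
  rw [tsum_eq_single a (by intro b hb; simp [hb])]
  simp

theorem PMF.tsum_mul_const_add {α : Type*} (p : PMF α) (a : ℝ≥0∞) (c : α → ℝ≥0∞) :
    ∑' b, p b * (a + c b) = a + ∑' b, p b * c b := by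
  simp_rw [mul_add]
  rw [ENNReal.tsum_add, ENNReal.tsum_mul_right, p.tsum_coe, one_mul]

theorem expectedBits_of_length_le_one {l : List ℝ} (h : l.length ≤ 1) : expectedBits l = 0 := by
  rw [expectedBits, quicksort, dif_pos h, PMF.tsum_pure_mul]
  simp

/-- The recurrence obtained by conditioning on the first pivot. -/
theorem length_mul_expectedBits {l : List ℝ} (h : ¬ l.length ≤ 1) :
    l.length * expectedBits l = ∑ i : Fin l.length,
      ((((l.eraseIdx i).map fun x => bitCost x (l.get i)).sum : ℝ≥0∞) +
        expectedBits ((l.eraseIdx i).filter fun x => x < l.get i) +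
        expectedBits ((l.eraseIdx i).filter fun x => ¬ x < l.get i)) := by
  have hl : (l.length : ℝ≥0∞) ≠ 0 := by
    simp only [ne_eq, Nat.cast_eq_zero]
    omega
  have : Nonempty (Fin l.length) := ⟨⟨0, by omega⟩⟩
  rw [expectedBits, quicksort, dif_neg h, PMF.tsum_bind_mul, tsum_fintype, Finset.mul_sum]
  refine Finset.sum_congr rfl fun i _ => ?_
  rw [PMF.uniformOfFintype_apply, Fintype.card_fin, ← mul_assoc,
    ENNReal.mul_inv_cancel hl (ENNReal.natCast_ne_top _), one_mul, PMF.tsum_bind_mul]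
  simp_rw [PMF.tsum_bind_mul, PMF.tsum_pure_mul, Nat.cast_add, PMF.tsum_mul_const_add]
  set A := (l.eraseIdx i).filter fun x => x < l.get i
  set B := (l.eraseIdx i).filter fun x => ¬ x < l.get i
  rw [add_right_comm, expectedBits.eq_1 A, ← PMF.tsum_mul_const_add]
  refine tsum_congr fun L => ?_
  rw [← expectedBits, add_right_comm]

/-- The mean number of bit comparisons made on the keys `s`: keys are compared at their `k`th bits
as often as by separate runs of Quicksort on the dyadic cells of rank `k`. -/
noncomputable def cellSum (s : Finset ℝ) : ℝ≥0∞ :=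
  ∑' k, ∑ j ∈ Finset.range (2 ^ k), (meanComparisons #{x ∈ s | dyadicIndex k x = j} : ℝ≥0∞)

theorem cellSum_of_card_le_one {s : Finset ℝ} (hs : #s ≤ 1) : cellSum s = 0 := by
  simp [cellSum, meanComparisons_of_le_one ((Finset.card_filter_le _ _).trans hs)]

theorem dyadicIndex_mono (k : ℕ) : Monotone (dyadicIndex k) := fun x y h =>
  Nat.floor_mono (mul_le_mul_of_nonneg_left h (by positivity))

/-- This is the pivot recurrence of Quicksort, obtained by summing the recurrence of each cell over
all ranks and cells. At each rank the pivot lies in a single cell, so the comparisons charged there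
add up to `bitCost`. -/
theorem card_mul_cellSum {s : Finset ℝ} (hs : ∀ x ∈ s, x ∈ Ico (0 : ℝ) 1) :
    #s * cellSum s = ∑ x ∈ s, (∑ y ∈ s.erase x, (bitCost y x : ℝ≥0∞) +
      cellSum {y ∈ s | y < x} + cellSum {y ∈ s | x < y}) := by
  have hbit : ∀ x ∈ s, ∑ y ∈ s.erase x, (bitCost y x : ℝ≥0∞) =
      ∑' k, ∑ j ∈ Finset.range (2 ^ k),
        (#{y ∈ s.erase x | dyadicIndex k x = j ∧ dyadicIndex k y = j} : ℝ≥0∞) := by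
    intro x hx
    rw [Finset.sum_congr rfl fun y hy => bitCost_eq_tsum (hs y (Finset.mem_of_mem_erase hy))
      (hs x hx) (Finset.ne_of_mem_erase hy),
      ← Summable.tsum_finsetSum fun _ _ => ENNReal.summable]
    refine tsum_congr fun k => ?_
    rw [Finset.sum_eq_single_of_mem _ (Finset.mem_range.2 (dyadicIndex_lt (hs x hx) k))]
    · simp
    · intro j _ hj
      simp [hj.symm]
  simp only [cellSum]
  rw [Finset.sum_congr rfl fun x hx => by rw [hbit x hx, ← ENNReal.tsum_add, ← ENNReal.tsum_add],
    ← Summable.tsum_finsetSum fun _ _ => ENNReal.summable, ← ENNReal.tsum_mul_left]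
  refine tsum_congr fun k => ?_
  simp_rw [← Finset.sum_add_distrib]
  rw [Finset.sum_comm, Finset.mul_sum]
  refine Finset.sum_congr rfl fun j _ => ?_
  have := card_mul_meanComparisons_filter s (fun x => dyadicIndex k x = j) fun x y z hxy hyz hx hz =>
    le_antisymm ((dyadicIndex_mono k hyz.le).trans_eq hz)
      (hx.symm.le.trans (dyadicIndex_mono k hxy.le))
  simp_rw [Finset.filter_filter]
  exact_mod_cast congrArg ((↑) : ℝ≥0 → ℝ≥0∞) this

/-- Both sides satisfy the same recurrence and vanish on lists with at most one key. -/
theorem expectedBits_eq_cellSum (l : List ℝ) (hl : l.Nodup) (h01 : ∀ x ∈ l, x ∈ Ico (0 : ℝ) 1) :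
    expectedBits l = cellSum l.toFinset := by
  induction hn : l.length using Nat.strong_induction_on generalizing l with
  | _ n ih =>
    subst hn
    have hcard : #l.toFinset = l.length := List.toFinset_card_of_nodup hl
    by_cases h : l.length ≤ 1
    · rw [expectedBits_of_length_le_one h, cellSum_of_card_le_one (hcard.trans_le h)]
    have hl0 : (l.length : ℝ≥0∞) ≠ 0 := by
      simp only [ne_eq, Nat.cast_eq_zero]
      omega
    rw [← ENNReal.mul_right_inj hl0 (ENNReal.natCast_ne_top _), length_mul_expectedBits h,
      congrArg Nat.cast hcard.symm, card_mul_cellSum (by simpa using h01), List.sum_toFinset _ hl, ← Fin.sum_univ_fun_getElem]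
    refine Finset.sum_congr rfl fun i _ => ?_
    have herase : l.eraseIdx i = l.erase l[i] := (hl.erase_getElem _ i.2).symm
    have hsub : ∀ p : ℝ → Bool,
        expectedBits ((l.eraseIdx i).filter p) = cellSum ((l.eraseIdx i).filter p).toFinset := by
      intro p
      have hlen : ((l.eraseIdx i).filter p).length < l.length := by
        refine (List.length_filter_le _ _).trans_lt ?_
        rw [List.length_eraseIdx_of_lt i.isLt]
        omega
      refine ih _ hlen _ ?_ ?_ rfl
      · exact (hl.sublist (List.eraseIdx_sublist _ _)).filter _
      · exact fun x hx => h01 x ((List.eraseIdx_sublist _ _).subset (List.mem_of_mem_filter hx))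
    rw [hsub, hsub]
    congr 1
    · congr 1
      · rw [herase, Nat.cast_list_sum, List.map_map, ← List.sum_toFinset _ (hl.erase _)]
        refine Finset.sum_congr ?_ fun x _ => rfl
        ext x
        simp [hl.mem_erase_iff]
      · congr 1
        ext x
        simp only [herase, List.get_eq_getElem, List.mem_toFinset, List.mem_filter,
          hl.mem_erase_iff, Finset.mem_filter, decide_eq_true_eq]
        exact ⟨fun h => ⟨h.1.2, h.2⟩, fun h => ⟨⟨h.2.ne, h.1⟩, h.2⟩⟩
    -- The pivot has been erased and the keys are distinct, so "not smaller than the pivot" means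
    -- "larger".
    · congr 1
      ext x
      simp only [herase, List.get_eq_getElem, List.mem_toFinset, List.mem_filter,
        hl.mem_erase_iff, Finset.mem_filter, decide_eq_true_eq, not_lt]
      exact ⟨fun h => ⟨h.1.2, h.2.lt_of_ne h.1.1.symm⟩, fun h => ⟨⟨h.2.ne', h.1⟩, h.2.le⟩⟩

/-! ### Independent keys and Poisson thinning -/

section Poissonization

/-- Two coordinates have joint law F × F, for which the diagonal is null because points are null. -/
theorem ae_injective_infinitePi (F : Measure ℝ) [IsProbabilityMeasure F] [NullSingletonClass F] :
    ∀ᵐ X ∂(Measure.infinitePi fun _ : ℕ => F), Function.Injective X := by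
  have hne : ∀ i j : ℕ, i ≠ j → ∀ᵐ X ∂(Measure.infinitePi fun _ : ℕ => F), X i ≠ X j := by
    intro i j hij
    have hind := (iIndepFun_infinitePi (P := fun _ : ℕ => F) (X := fun _ x => x)
      (fun _ => measurable_id)).indepFun hij
    have hmi : ∀ i : ℕ, Measurable fun X : ℕ → ℝ => X i := fun i => measurable_pi_apply i
    rw [indepFun_iff_map_prod_eq_prod_map_map (hmi i).aemeasurable (hmi j).aemeasurable] at hind
    have hmap : ∀ i : ℕ, (Measure.infinitePi fun _ : ℕ => F).map (fun X : ℕ → ℝ => X i) = F :=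
      fun i => Measure.infinitePi_map_eval (fun _ : ℕ => F) i
    rw [hmap, hmap] at hind
    have hdiag : MeasurableSet {p : ℝ × ℝ | p.1 = p.2} :=
      measurableSet_eq_fun measurable_fst measurable_snd
    have h0 : (F.prod F) {p : ℝ × ℝ | p.1 = p.2} = 0 := by
      rw [Measure.measure_prod_null hdiag]
      refine ae_of_all _ fun x => ?_
      have : Prod.mk x ⁻¹' {p : ℝ × ℝ | p.1 = p.2} = {x} := by
        ext y
        simp [eq_comm]
      simp [this]
    rw [← hind, Measure.map_apply (by fun_prop) hdiag] at h0
    rw [ae_iff]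
    simpa using h0
  have hall : ∀ᵐ X ∂(Measure.infinitePi fun _ : ℕ => F), ∀ i j : ℕ, i ≠ j → X i ≠ X j := by
    simp only [ae_all_iff]
    exact hne
  filter_upwards [hall] with X hX i j hij
  by_contra hcon
  exact hX i j hcon hij

theorem ae_forall_mem_infinitePi {F : Measure ℝ} [IsProbabilityMeasure F] {s : Set ℝ}
    (hF : ∀ᵐ x ∂F, x ∈ s) : ∀ᵐ X ∂(Measure.infinitePi fun _ : ℕ => F), ∀ i, X i ∈ s := by
  rw [ae_all_iff]
  intro i
  have h : ∀ᵐ x ∂((Measure.infinitePi fun _ : ℕ => F).map fun X : ℕ → ℝ => X i), x ∈ s := by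
    rw [show (Measure.infinitePi fun _ : ℕ => F).map (fun X : ℕ → ℝ => X i) = F from
      Measure.infinitePi_map_eval (fun _ : ℕ => F) i]
    exact hF
  exact ae_of_ae_map (measurable_pi_apply i).aemeasurable h

theorem expectedBits_map_range {X : ℕ → ℝ} (hX : Function.Injective X)
    (h01 : ∀ i, X i ∈ Ico (0 : ℝ) 1) (n : ℕ) :
    expectedBits ((List.range n).map X) = ∑' k, ∑ j ∈ Finset.range (2 ^ k),
      (meanComparisons #{i ∈ Finset.range n | dyadicIndex k (X i) = j} : ℝ≥0∞) := by
  rw [expectedBits_eq_cellSum _ (List.nodup_range.map hX)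
    (by simp only [List.mem_map]; rintro _ ⟨i, -, rfl⟩; exact h01 i), cellSum]
  refine tsum_congr fun k => Finset.sum_congr rfl fun j _ => ?_
  have : ((List.range n).map X).toFinset = (Finset.range n).image X := by
    ext x
    simp
  rw [this, Finset.filter_image, Finset.card_image_of_injective _ hX]

/-- The number of `X 0, …, X (n - 1)` that fall into a given set is binomial. -/
theorem lintegral_card_filter_infinitePi (F : Measure ℝ) [IsProbabilityMeasure F] {C : ℝ → Prop}
    [DecidablePred C] (hC : MeasurableSet {x | C x}) (φ : ℕ → ℝ≥0∞) (n : ℕ) :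
    ∫⁻ X : ℕ → ℝ, φ #{i ∈ Finset.range n | C (X i)} ∂(Measure.infinitePi fun _ : ℕ => F) =
      ∑ p ∈ Finset.HasAntidiagonal.antidiagonal n,
        n.choose p.1 * (F {x | C x} ^ p.1 * F {x | C x}ᶜ ^ p.2) * φ p.1 := by
  set t : Finset ℕ → ℕ → Set ℝ := fun A i => if i ∈ A then {x | C x} else {x | C x}ᶜ with ht
  have htm : ∀ A i, MeasurableSet (t A i) := by
    intro A i
    simp only [ht]
    split_ifs
    exacts [hC, hC.compl]
  -- The space is partitioned according to the exact set `A` of indices whose keys fall into `C`;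
  -- the mass of each piece depends only on `#A`.
  have hpt : ∀ X : ℕ → ℝ, φ #{i ∈ Finset.range n | C (X i)} =
      ∑ A ∈ (Finset.range n).powerset,
        (Set.pi (Finset.range n : Set ℕ) (t A)).indicator (fun _ => φ #A) X := by
    intro X
    have hmem : ∀ A ∈ (Finset.range n).powerset,
        X ∈ Set.pi (Finset.range n : Set ℕ) (t A) ↔ {i ∈ Finset.range n | C (X i)} = A := by
      intro A hA
      rw [Finset.mem_powerset] at hA
      simp only [Set.mem_pi, ht, Finset.ext_iff, Finset.mem_filter, Finset.mem_coe]
      refine forall_congr' fun i => ?_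
      by_cases hi : i ∈ A
      · simp [hi, hA hi]
      · by_cases hin : i ∈ Finset.range n <;> simp_all
    rw [Finset.sum_eq_single_of_mem {i ∈ Finset.range n | C (X i)} (by simp)]
    · rw [indicator_of_mem ((hmem _ (by simp)).2 rfl)]
    · intro A hA hne
      exact indicator_of_notMem (fun h => hne ((hmem A hA).1 h).symm) _
  simp_rw [hpt]
  have hms : ∀ A, MeasurableSet (Set.pi (Finset.range n : Set ℕ) (t A)) := fun A =>
    MeasurableSet.pi (Finset.countable_toSet _) fun i _ => htm A i
  rw [lintegral_finsetSum _ fun A _ => measurable_const.indicator (hms A)]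
  have hval : ∀ A ∈ (Finset.range n).powerset,
      ∫⁻ X : ℕ → ℝ, (Set.pi (Finset.range n : Set ℕ) (t A)).indicator (fun _ => φ #A) X
        ∂(Measure.infinitePi fun _ : ℕ => F) =
      F {x | C x} ^ #A * F {x | C x}ᶜ ^ (n - #A) * φ #A := by
    intro A hA
    rw [Finset.mem_powerset] at hA
    rw [lintegral_indicator_const (hms A), Measure.infinitePi_pi _ fun i _ => htm A i, mul_comm]
    congr 1
    have : ∀ i, F (t A i) = if i ∈ A then F {x | C x} else F {x | C x}ᶜ := by
      intro i
      simp only [ht]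
      split_ifs <;> rfl
    simp_rw [this]
    rw [Finset.prod_ite, Finset.prod_const, Finset.prod_const, Finset.filter_mem_eq_inter,
      Finset.inter_eq_right.2 hA, Finset.filter_notMem_eq_sdiff, Finset.card_sdiff_of_subset hA,
      Finset.card_range]
  rw [Finset.sum_congr rfl hval, Finset.sum_powerset_apply_card
    (fun m => F {x | C x} ^ m * F {x | C x}ᶜ ^ (n - m) * φ m), Finset.card_range,
    Finset.Nat.sum_antidiagonal_eq_sum_range_succ_mk]
  refine Finset.sum_congr rfl fun m _ => ?_
  rw [nsmul_eq_mul, mul_assoc, mul_assoc, mul_assoc]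

theorem lintegral_poissonMeasure (r : ℝ≥0) (φ : ℕ → ℝ≥0∞) :
    ∫⁻ n, φ n ∂(poissonMeasure r) =
      ∑' n, ENNReal.ofReal (Real.exp (-r) * r ^ n / n.factorial) * φ n := by
  rw [lintegral_countable']
  refine tsum_congr fun n => ?_
  rw [poissonMeasure_singleton, mul_comm]

theorem tsum_antidiagonal {A : Type*} [AddMonoid A] [Finset.HasAntidiagonal A]
    (G : A × A → ℝ≥0∞) :
    ∑' n, ∑ p ∈ Finset.HasAntidiagonal.antidiagonal n, G p = ∑' a, ∑' b, G (a, b) := by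
  rw [← ENNReal.tsum_prod, ← Finset.HasAntidiagonal.sigmaAntidiagonalEquivProd.tsum_eq, ENNReal.tsum_sigma']
  refine tsum_congr fun n => ?_
  rw [tsum_fintype, ← Finset.sum_coe_sort]
  rfl

/-- Poisson thinning. -/
theorem lintegral_poissonMeasure_thinning (r p q : ℝ≥0) (hpq : p + q = 1) (φ : ℕ → ℝ≥0∞) :
    ∫⁻ n, ∑ a ∈ Finset.HasAntidiagonal.antidiagonal n, (n.choose a.1 : ℝ≥0∞) * ((p : ℝ≥0∞) ^ a.1 * (q : ℝ≥0∞) ^ a.2)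
      * φ a.1 ∂(poissonMeasure r) = ∫⁻ m, φ m ∂(poissonMeasure (r * p)) := by
  set w : ℝ≥0 → ℕ → ℝ≥0∞ := fun s n => ENNReal.ofReal (Real.exp (-s) * s ^ n / n.factorial) with hw
  -- Summing the weights of the number of keys outside the set removes that number from the formula.
  have hone : ∑' b, w (r * q) b = 1 := by
    have := lintegral_poissonMeasure (r * q) 1
    simpa [w] using this.symm
  -- As r = rp + rq, a Poisson weight times a binomial weight splits into two independent Poisson
  -- weights.
  have hterm : ∀ n, w r n * ∑ a ∈ Finset.HasAntidiagonal.antidiagonal n,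
      (n.choose a.1 : ℝ≥0∞) * ((p : ℝ≥0∞) ^ a.1 * (q : ℝ≥0∞) ^ a.2) * φ a.1 =
      ∑ a ∈ Finset.HasAntidiagonal.antidiagonal n, w (r * p) a.1 * φ a.1 * w (r * q) a.2 := by
    intro n
    rw [Finset.mul_sum]
    refine Finset.sum_congr rfl fun a ha => ?_
    obtain rfl := Finset.HasAntidiagonal.mem_antidiagonal.1 ha
    rw [mul_right_comm _ (φ a.1), ← mul_assoc]
    congr 1
    have hc : ((a.1 + a.2).choose a.1 : ℝ) * a.1.factorial * a.2.factorial =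
        (a.1 + a.2).factorial := by
      rw [← Nat.add_choose_mul_factorial_mul_factorial a.1 a.2, Nat.choose_symm_add]
      push_cast
      ring
    have he : Real.exp (-r) = Real.exp (-(r * p)) * Real.exp (-(r * q)) := by
      rw [← Real.exp_add]
      congr 1
      have : (p : ℝ) + q = 1 := by exact_mod_cast hpq
      linear_combination (r : ℝ) * this
    rw [← ENNReal.coe_pow, ← ENNReal.coe_pow, ← ENNReal.coe_mul, ← ENNReal.ofReal_coe_nnreal,
      ← ENNReal.ofReal_natCast, hw, ← ENNReal.ofReal_mul (by positivity),
      ← ENNReal.ofReal_mul (by positivity), ← ENNReal.ofReal_mul (by positivity)]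
    congr 1
    push_cast
    rw [he, ← hc]
    have h1 : (a.1.factorial : ℝ) ≠ 0 := by positivity
    have h2 : (a.2.factorial : ℝ) ≠ 0 := by positivity
    have h3 : ((a.1 + a.2).choose a.1 : ℝ) ≠ 0 := by
      have := Nat.choose_pos (Nat.le_add_right a.1 a.2)
      positivity
    field_simp
    ring
  rw [lintegral_poissonMeasure, lintegral_poissonMeasure, tsum_congr hterm,
    tsum_antidiagonal fun a => w (r * p) a.1 * φ a.1 * w (r * q) a.2]
  refine tsum_congr fun a => ?_
  simp only
  rw [ENNReal.tsum_mul_left, hone, mul_one]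

theorem measurable_dyadicIndex (k : ℕ) : Measurable (dyadicIndex k) :=
  Nat.measurable_floor.comp (measurable_const_mul _)

/-- The mean number of bit comparisons, as a sum over all dyadic cells of mean numbers of key
comparisons. -/
theorem meanBits_eq_tsum (F : Measure ℝ) [IsProbabilityMeasure F] [NullSingletonClass F]
    (hF : ∀ᵐ x ∂F, x ∈ Ico (0 : ℝ) 1) (lam : ℝ≥0) :
    meanBits F lam = ∑' k, ∑ j ∈ Finset.range (2 ^ k),
      ∫⁻ m, (meanComparisons m : ℝ≥0∞)
        ∂(poissonMeasure (lam * (F {x | dyadicIndex k x = j}).toNNReal)) := by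
  -- Once the cost is replaced almost everywhere by cell counts, only the measurability of those
  -- counts is needed.
  have hae : ∀ᵐ ω ∂((Measure.infinitePi fun _ : ℕ => F).prod (poissonMeasure lam)),
      expectedBits ((List.range ω.2).map ω.1) = ∑' k, ∑ j ∈ Finset.range (2 ^ k),
        (meanComparisons #{i ∈ Finset.range ω.2 | dyadicIndex k (ω.1 i) = j} : ℝ≥0∞) := by
    have h1 := Measure.quasiMeasurePreserving_fst
      (μ := Measure.infinitePi fun _ : ℕ => F) (ν := poissonMeasure lam)
    filter_upwards [h1.ae (ae_injective_infinitePi F), h1.ae (ae_forall_mem_infinitePi hF)]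
      with ω hinj h01
    exact expectedBits_map_range hinj h01 ω.2
  have hC : ∀ k j, MeasurableSet {x | dyadicIndex k x = j} := fun k j =>
    measurable_dyadicIndex k (measurableSet_singleton j)
  have hmeas : ∀ k j, Measurable fun ω : (ℕ → ℝ) × ℕ =>
      (meanComparisons #{i ∈ Finset.range ω.2 | dyadicIndex k (ω.1 i) = j} : ℝ≥0∞) := by
    intro k j
    refine measurable_from_prod_countable_left fun n => ?_
    refine (measurable_from_nat (f := fun m => (meanComparisons m : ℝ≥0∞))).comp ?_
    simp_rw [Finset.card_filter]
    refine Finset.measurable_fun_sum _ fun i _ => ?_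
    exact Measurable.ite ((measurable_pi_apply (X := fun _ : ℕ => ℝ) i) (hC k j)) measurable_const measurable_const
  rw [meanBits, lintegral_congr_ae hae,
    lintegral_tsum fun k => (Finset.measurable_fun_sum _ fun j _ => hmeas k j).aemeasurable]
  refine tsum_congr fun k => ?_
  rw [lintegral_finsetSum _ fun j _ => hmeas k j]
  refine Finset.sum_congr rfl fun j _ => ?_
  have hsum : (F {x | dyadicIndex k x = j}).toNNReal + (F {x | dyadicIndex k x = j}ᶜ).toNNReal
      = 1 := by
    rw [← ENNReal.toNNReal_add (measure_ne_top _ _) (measure_ne_top _ _),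
      measure_add_measure_compl (hC k j), measure_univ, ENNReal.toNNReal_one]
  rw [lintegral_prod_symm' _ (hmeas k j), ← lintegral_poissonMeasure_thinning _ _ _ hsum]
  refine lintegral_congr fun n => ?_
  rw [ENNReal.coe_toNNReal (measure_ne_top _ _), ENNReal.coe_toNNReal (measure_ne_top _ _)]
  exact lintegral_card_filter_infinitePi F (hC k j) (fun m => (meanComparisons m : ℝ≥0∞)) n

end Poissonization

/-! ### An integral formula for a Poisson number of keys, and its convexity -/

section PoissonComparisons

/-- The integrand in the representation of the mean number of key comparisons. -/
noncomputable def comparisonKernel (t w : ℝ) : ℝ :=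
  2 * (1 - w) * ((Real.exp (-(t * w)) - 1 + t * w) / w ^ 2)

/-- The mean number of key comparisons made by Quicksort on a Poisson number of mean `t` of keys. -/
noncomputable def poissonComparisons (t : ℝ) : ℝ := ∫ w in Ioc 0 1, comparisonKernel t w

theorem exp_neg_sub_one_add_nonneg (x : ℝ) : 0 ≤ Real.exp (-x) - 1 + x := by
  linarith [Real.add_one_le_exp (-x)]

theorem exp_neg_sub_one_add_le {x : ℝ} (hx : 0 ≤ x) :
    Real.exp (-x) - 1 + x ≤ x ^ 2 / (1 + x) := by
  have h1 : 0 < 1 + x := by linarith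
  have h2 : Real.exp (-x) ≤ 1 / (1 + x) := by
    rw [Real.exp_neg, ← one_div]
    exact one_div_le_one_div_of_le h1 (by linarith [Real.add_one_le_exp x])
  have h3 : x ^ 2 / (1 + x) = 1 / (1 + x) - 1 + x := by
    field_simp
    ring
  linarith

/-- Valid for all real x, this makes the kernel integrable for negative t too. Convexity then holds
on the whole line and yields continuity. -/
theorem exp_neg_sub_one_add_le_sq_mul_exp (x : ℝ) :
    Real.exp (-x) - 1 + x ≤ x ^ 2 * Real.exp |x| := by
  have h := Complex.norm_exp_sub_sum_le_norm_mul_exp ((-x : ℝ) : ℂ) 2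
  simp only [Finset.sum_range_succ, Finset.sum_range_zero, pow_zero, pow_one, zero_add,
    Nat.factorial, Nat.cast_one, div_one, mul_one] at h
  rw [← Complex.ofReal_exp, ← Complex.ofReal_one, ← Complex.ofReal_add, ← Complex.ofReal_sub,
    Complex.norm_real, Complex.norm_real, Real.norm_eq_abs, Real.norm_eq_abs, abs_neg, sq_abs] at h
  refine le_trans (le_of_eq ?_) ((le_abs_self _).trans h)
  ring

theorem comparisonKernel_nonneg (t : ℝ) {w : ℝ} (hw : w ∈ Ioc (0 : ℝ) 1) :
    0 ≤ comparisonKernel t w :=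
  mul_nonneg (by linarith [hw.2]) (div_nonneg (exp_neg_sub_one_add_nonneg _) (sq_nonneg _))

theorem measurable_comparisonKernel (t : ℝ) : Measurable (comparisonKernel t) := by
  unfold comparisonKernel
  fun_prop

theorem integrableOn_comparisonKernel (t : ℝ) : IntegrableOn (comparisonKernel t) (Ioc 0 1) := by
  refine Measure.integrableOn_of_bounded (M := 2 * (t ^ 2 * Real.exp |t|)) (by simp)
    (measurable_comparisonKernel t).aestronglyMeasurable ?_
  filter_upwards [ae_restrict_mem measurableSet_Ioc] with w hw
  rw [Real.norm_of_nonneg (comparisonKernel_nonneg t hw), comparisonKernel]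
  have hw0 : 0 < w := hw.1
  have h1 : (Real.exp (-(t * w)) - 1 + t * w) / w ^ 2 ≤ t ^ 2 * Real.exp |t| := by
    rw [div_le_iff₀ (by positivity)]
    refine (exp_neg_sub_one_add_le_sq_mul_exp _).trans ?_
    have h2 : |t * w| ≤ |t| := by
      rw [abs_mul, abs_of_pos hw0]
      exact mul_le_of_le_one_right (abs_nonneg t) hw.2
    calc (t * w) ^ 2 * Real.exp |t * w| ≤ (t * w) ^ 2 * Real.exp |t| := by gcongr
      _ = t ^ 2 * Real.exp |t| * w ^ 2 := by ring
  exact mul_le_mul (by linarith) h1 (div_nonneg (exp_neg_sub_one_add_nonneg _) (sq_nonneg _))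
    (by norm_num)

theorem poissonComparisons_nonneg (t : ℝ) : 0 ≤ poissonComparisons t :=
  setIntegral_nonneg measurableSet_Ioc fun _ hw => comparisonKernel_nonneg t hw

@[simp] theorem poissonComparisons_zero : poissonComparisons 0 = 0 := by
  simp [poissonComparisons, comparisonKernel]

/-- For each w in (0, 1] the kernel is a nonnegative multiple of an exponential plus an affine
function of t. -/
theorem convexOn_poissonComparisons : ConvexOn ℝ univ poissonComparisons := by
  refine ⟨convex_univ, fun x _ y _ a b ha hb hab => ?_⟩
  simp only [poissonComparisons, smul_eq_mul]
  rw [← integral_const_mul, ← integral_const_mul, ← integral_add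
    ((integrableOn_comparisonKernel x).const_mul a) ((integrableOn_comparisonKernel y).const_mul b)]
  refine setIntegral_mono_on (integrableOn_comparisonKernel _)
    (((integrableOn_comparisonKernel x).const_mul a).add
      ((integrableOn_comparisonKernel y).const_mul b)) measurableSet_Ioc fun w hw => ?_
  have h := convexOn_exp.2 (mem_univ (-(x * w))) (mem_univ (-(y * w))) ha hb hab
  simp only [smul_eq_mul] at h
  have h1 : -((a * x + b * y) * w) = a * -(x * w) + b * -(y * w) := by ring
  have h2 : a * comparisonKernel x w + b * comparisonKernel y w =
      2 * (1 - w) * ((a * Real.exp (-(x * w)) + b * Real.exp (-(y * w)) - 1 +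
        (a * x + b * y) * w) / w ^ 2) := by
    simp only [comparisonKernel]
    linear_combination (-2 * (1 - w) / w ^ 2) * hab
  rw [h2, comparisonKernel, h1]
  have : 0 ≤ 1 - w := by linarith [hw.2]
  gcongr

theorem continuous_poissonComparisons : Continuous poissonComparisons :=
  continuousOn_univ.1 (convexOn_poissonComparisons.continuousOn isOpen_univ)

theorem poissonComparisons_le_sq {t : ℝ} (ht : 0 ≤ t) : poissonComparisons t ≤ 2 * t ^ 2 := by
  have h : poissonComparisons t ≤ ∫ _ in Ioc (0 : ℝ) 1, 2 * t ^ 2 := by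
    refine setIntegral_mono_on (integrableOn_comparisonKernel t) (integrable_const _) measurableSet_Ioc
      fun w hw => ?_
    have hw0 : 0 < w := hw.1
    have h1 : (Real.exp (-(t * w)) - 1 + t * w) / w ^ 2 ≤ t ^ 2 := by
      rw [div_le_iff₀ (by positivity)]
      refine (exp_neg_sub_one_add_le (by positivity)).trans ?_
      rw [← mul_pow]
      exact div_le_self (by positivity) (by nlinarith)
    exact mul_le_mul (by linarith) h1 (div_nonneg (exp_neg_sub_one_add_nonneg _) (sq_nonneg _))
      (by norm_num)
  simpa using h

theorem integral_two_mul_one_sub_pow (j : ℕ) :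
    ∫ w in (0 : ℝ)..1, 2 * (1 - w) ^ (j + 1) = 2 / ((j : ℝ) + 2) := by
  rw [intervalIntegral.integral_const_mul,
    intervalIntegral.integral_comp_sub_left (fun x : ℝ => x ^ (j + 1)), integral_pow]
  push_cast
  simp only [sub_self, sub_zero, one_pow, ne_eq, Nat.add_eq_zero_iff, one_ne_zero, and_false,
    not_false_eq_true, zero_pow]
  ring

/-- Summing the geometric series twice cancels the singular factor w⁻². The resulting terms
integrate to the summands 2 / (j + 2) of `meanComparisons`. -/
theorem two_mul_one_sub_mul_eq_sum (m : ℕ) {w : ℝ} (hw : w ∈ Ioc (0 : ℝ) 1) :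
    2 * (1 - w) * (((1 - w) ^ m - 1 + m * w) / w ^ 2) =
      ∑ i ∈ Finset.range m, ∑ j ∈ Finset.range i, 2 * (1 - w) ^ (j + 1) := by
  have hw0 : w ≠ 0 := hw.1.ne'
  have h1 : ∀ i, w * ∑ j ∈ Finset.range i, (1 - w) ^ j = 1 - (1 - w) ^ i := by
    intro i
    have := mul_neg_geom_sum (1 - w) i
    simpa using this
  have h2 : w ^ 2 * ∑ i ∈ Finset.range m, ∑ j ∈ Finset.range i, (1 - w) ^ j =
      (1 - w) ^ m - 1 + m * w := by
    rw [sq, mul_assoc, Finset.mul_sum, Finset.sum_congr rfl fun i _ => h1 i,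
      Finset.sum_sub_distrib, mul_sub, h1]
    simp
    ring
  rw [← h2, mul_div_cancel_left₀ _ (by positivity), Finset.mul_sum]
  refine Finset.sum_congr rfl fun i _ => ?_
  rw [Finset.mul_sum]
  refine Finset.sum_congr rfl fun j _ => ?_
  ring

theorem meanComparisons_eq_integral (m : ℕ) : (meanComparisons m : ℝ) =
    ∫ w in Ioc (0 : ℝ) 1, 2 * (1 - w) * (((1 - w) ^ m - 1 + m * w) / w ^ 2) := by
  rw [setIntegral_congr_fun measurableSet_Ioc fun w hw => two_mul_one_sub_mul_eq_sum m hw, ← intervalIntegral.integral_of_le zero_le_one,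
    intervalIntegral.integral_finsetSum
      fun i _ => Continuous.intervalIntegrable (by fun_prop) _ _, meanComparisons]
  push_cast
  refine Finset.sum_congr rfl fun i _ => ?_
  rw [intervalIntegral.integral_finsetSum
      fun i _ => Continuous.intervalIntegrable (by fun_prop) _ _]
  exact Finset.sum_congr rfl fun j _ => (integral_two_mul_one_sub_pow j).symm

theorem one_sub_pow_sub_one_add_nonneg {w : ℝ} (hw : w ∈ Ioc (0 : ℝ) 1) (m : ℕ) :
    0 ≤ (1 - w) ^ m - 1 + m * w := by
  have := one_add_mul_le_pow (a := -w) (by linarith [hw.2]) m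
  rw [← sub_eq_add_neg] at this
  linarith

/-- The Poisson generating function turns (1 - w) ^ m into exp(-tw), and the Poisson mean turns m w
into t w. -/
theorem hasSum_poisson_comparisonKernel (t w : ℝ) :
    HasSum (fun m : ℕ => Real.exp (-t) * t ^ m / m.factorial *
      (2 * (1 - w) * (((1 - w) ^ m - 1 + m * w) / w ^ 2))) (comparisonKernel t w) := by
  have hexp : ∀ x : ℝ, HasSum (fun m : ℕ => x ^ m / m.factorial) (Real.exp x) := by
    intro x
    rw [Real.exp_eq_exp_ℝ]
    exact NormedSpace.expSeries_div_hasSum_exp x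
  have hlin : HasSum (fun m : ℕ => (m : ℝ) * (t ^ m / m.factorial)) (t * Real.exp t) := by
    rw [← hasSum_nat_add_iff' 1]
    simp only [Finset.range_one, Finset.sum_singleton, Nat.cast_zero, zero_mul, sub_zero]
    convert! (hexp t).mul_left t using 2 with m
    rw [Nat.factorial_succ]
    push_cast
    rw [pow_succ']
    field_simp
  have h := ((((hexp (t * (1 - w))).sub (hexp t)).add (hlin.mul_left w)).mul_left
    (Real.exp (-t) * (2 * (1 - w) / w ^ 2)))
  convert! h using 1
  · funext m
    rw [mul_pow]
    ring
  · have h1 : Real.exp (-t) * Real.exp (t * (1 - w)) = Real.exp (-(t * w)) := by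
      rw [← Real.exp_add]
      ring_nf
    have h2 : Real.exp (-t) * Real.exp t = 1 := by simp [← Real.exp_add]
    rw [comparisonKernel]
    linear_combination (-(2 * (1 - w) / w ^ 2)) * h1 + ((2 * (1 - w) / w ^ 2) * (1 - w * t)) * h2

/-- The Poisson sum and the integral over w may be exchanged because all terms are nonnegative, by
Bernoulli's inequality. -/
theorem lintegral_meanComparisons_poissonMeasure (t : ℝ≥0) :
    ∫⁻ m, (meanComparisons m : ℝ≥0∞) ∂(poissonMeasure t) =
      ENNReal.ofReal (poissonComparisons t) := by
  have hint : ∀ m : ℕ, IntegrableOn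
      (fun w : ℝ => 2 * (1 - w) * (((1 - w) ^ m - 1 + m * w) / w ^ 2)) (Ioc 0 1) := by
    intro m
    refine IntegrableOn.congr_fun (Continuous.integrableOn_Ioc ?_)
      (fun w hw => (two_mul_one_sub_mul_eq_sum m hw).symm) measurableSet_Ioc
    fun_prop
  rw [lintegral_poissonMeasure, poissonComparisons, ofReal_integral_eq_lintegral_ofReal
    (integrableOn_comparisonKernel t)
    ((ae_restrict_mem measurableSet_Ioc).mono fun w hw => comparisonKernel_nonneg t hw)]
  have hnn : ∀ m : ℕ, ∀ w ∈ Ioc (0 : ℝ) 1,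
      0 ≤ 2 * (1 - w) * (((1 - w) ^ m - 1 + m * w) / w ^ 2) := fun m w hw =>
    mul_nonneg (by linarith [hw.2]) (div_nonneg (one_sub_pow_sub_one_add_nonneg hw m) (sq_nonneg _))
  have hterm : ∀ m : ℕ, ENNReal.ofReal (Real.exp (-t) * t ^ m / m.factorial) *
      (meanComparisons m : ℝ≥0∞) = ∫⁻ w in Ioc (0 : ℝ) 1,
        ENNReal.ofReal (Real.exp (-t) * t ^ m / m.factorial *
          (2 * (1 - w) * (((1 - w) ^ m - 1 + m * w) / w ^ 2))) := by
    intro m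
    rw [← ENNReal.ofReal_coe_nnreal, meanComparisons_eq_integral,
      ofReal_integral_eq_lintegral_ofReal (hint m)
      ((ae_restrict_mem measurableSet_Ioc).mono fun w hw => hnn m w hw),
      ← lintegral_const_mul _ (by fun_prop)]
    exact lintegral_congr fun w => (ENNReal.ofReal_mul (by positivity)).symm
  simp_rw [hterm]
  rw [← lintegral_tsum fun m => by fun_prop]
  refine setLIntegral_congr_fun measurableSet_Ioc fun w hw => ?_
  have hs := hasSum_poisson_comparisonKernel t w
  rw [← hs.tsum_eq]
  exact (ENNReal.ofReal_tsum_of_nonneg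
    (fun m => mul_nonneg (by positivity) (hnn m w hw)) hs.summable).symm

end PoissonComparisons

/-! ### Logarithmic growth of the comparisons per key -/

section Growth

/-- The mean number of key comparisons per key. -/
noncomputable def comparisonRate (t : ℝ) : ℝ := poissonComparisons t / t

theorem mul_comparisonRate (t : ℝ) : t * comparisonRate t = poissonComparisons t := by
  rcases eq_or_ne t 0 with rfl | ht
  · simp
  · rw [comparisonRate, mul_div_cancel₀ _ ht]

theorem comparisonRate_nonneg {t : ℝ} (ht : 0 ≤ t) : 0 ≤ comparisonRate t :=
  div_nonneg (poissonComparisons_nonneg t) ht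

theorem comparisonRate_le {t : ℝ} (ht : 0 ≤ t) : comparisonRate t ≤ 2 * t := by
  rcases ht.eq_or_lt with rfl | ht0
  · simp [comparisonRate]
  · rw [comparisonRate, div_le_iff₀ ht0]
    linarith [poissonComparisons_le_sq ht]

/-- The slope of the chord from the origin of a convex function increases. -/
theorem ConvexOn.div_le_div_of_le {φ : ℝ → ℝ} (hφ : ConvexOn ℝ univ φ) (h0 : φ 0 = 0) {s t : ℝ}
    (hs : 0 < s) (hst : s ≤ t) : φ s / s ≤ φ t / t := by
  have ht : 0 < t := hs.trans_le hst
  have h := hφ.2 (mem_univ t) (mem_univ 0) (div_nonneg hs.le ht.le)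
    (sub_nonneg.2 ((div_le_one ht).2 hst)) (by ring)
  simp only [smul_eq_mul, mul_zero, add_zero, h0, div_mul_cancel₀ s ht.ne'] at h
  rw [div_le_iff₀ hs]
  calc φ s ≤ s / t * φ t := h
    _ = φ t / t * s := by ring

theorem monotoneOn_comparisonRate : MonotoneOn comparisonRate (Ici 0) := by
  intro s hs t ht hst
  rcases (mem_Ici.1 hs).eq_or_lt with rfl | hs0
  · simpa [comparisonRate] using comparisonRate_nonneg ht
  · exact convexOn_poissonComparisons.div_le_div_of_le poissonComparisons_zero hs0 hst

/-- The function `(e⁻ˣ - 1 + x) / x`, which increases from `0` to `1` on `[0, ∞)`. -/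
noncomputable def expRemainder (x : ℝ) : ℝ := (Real.exp (-x) - 1 + x) / x

theorem expRemainder_nonneg {x : ℝ} (hx : 0 ≤ x) : 0 ≤ expRemainder x :=
  div_nonneg (exp_neg_sub_one_add_nonneg x) hx

theorem expRemainder_le_one {x : ℝ} (hx : 0 ≤ x) : expRemainder x ≤ 1 := by
  refine div_le_one_of_le₀ ?_ hx
  have : Real.exp (-x) ≤ 1 := Real.exp_le_one_iff.2 (by linarith)
  linarith

theorem expRemainder_div_le_one {x : ℝ} (hx : 0 ≤ x) : expRemainder x / x ≤ 1 := by
  rcases hx.eq_or_lt with rfl | hx0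
  · simp
  rw [expRemainder, div_div, div_le_one (by positivity), ← sq]
  exact (exp_neg_sub_one_add_le hx).trans (div_le_self (by positivity) (by linarith))

theorem one_sub_inv_le_expRemainder {x : ℝ} (hx : 0 < x) : 1 - 1 / x ≤ expRemainder x := by
  rw [expRemainder, le_div_iff₀ hx, sub_mul, div_mul_cancel₀ _ hx.ne']
  linarith [Real.exp_pos (-x)]

theorem convexOn_exp_neg_sub_one_add :
    ConvexOn ℝ univ fun x : ℝ => Real.exp (-x) - 1 + x := by
  refine ⟨convex_univ, fun x _ y _ a b ha hb hab => ?_⟩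
  have h := convexOn_exp.2 (mem_univ (-x)) (mem_univ (-y)) ha hb hab
  simp only [smul_eq_mul] at h ⊢
  have h1 : -(a * x + b * y) = a * -x + b * -y := by ring
  rw [h1]
  linarith

theorem monotoneOn_expRemainder : MonotoneOn expRemainder (Ici 0) := by
  intro s hs t ht hst
  rcases (mem_Ici.1 hs).eq_or_lt with rfl | hs0
  · simpa [expRemainder] using expRemainder_nonneg ht
  · exact convexOn_exp_neg_sub_one_add.div_le_div_of_le (by simp) hs0 hst

theorem measurable_expRemainder : Measurable expRemainder := by
  unfold expRemainder
  fun_prop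

theorem intervalIntegrable_of_measurable_of_le_one {φ : ℝ → ℝ} (hφ : Measurable φ) {a b : ℝ}
    (hab : a ≤ b) (h : ∀ x ∈ Ioc a b, 0 ≤ φ x ∧ φ x ≤ 1) : IntervalIntegrable φ volume a b := by
  rw [intervalIntegrable_iff_integrableOn_Ioc_of_le hab]
  refine Measure.integrableOn_of_bounded (M := 1) (by simp) hφ.aestronglyMeasurable ?_
  filter_upwards [ae_restrict_mem measurableSet_Ioc] with x hx
  rw [Real.norm_of_nonneg (h x hx).1]
  exact (h x hx).2

theorem intervalIntegrable_expRemainder_div {a b : ℝ} (ha : 0 ≤ a) (hab : a ≤ b) :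
    IntervalIntegrable (fun x => expRemainder x / x) volume a b :=
  intervalIntegrable_of_measurable_of_le_one (measurable_expRemainder.div measurable_id) hab
    fun _ hx => have hx0 := ha.trans hx.1.le
      ⟨div_nonneg (expRemainder_nonneg hx0) hx0, expRemainder_div_le_one hx0⟩

theorem intervalIntegrable_expRemainder_mul {t : ℝ} (ht : 0 ≤ t) :
    IntervalIntegrable (fun w => expRemainder (t * w)) volume 0 1 :=
  intervalIntegrable_of_measurable_of_le_one
    (measurable_expRemainder.comp (measurable_const_mul t)) zero_le_one
    fun _ hx => have hx0 := mul_nonneg ht hx.1.le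
      ⟨expRemainder_nonneg hx0, expRemainder_le_one hx0⟩

/-- The mean of `expRemainder` over `[0, t]`. -/
noncomputable def meanExpRemainder (t : ℝ) : ℝ := ∫ w in (0 : ℝ)..1, expRemainder (t * w)

theorem meanExpRemainder_nonneg {t : ℝ} (ht : 0 ≤ t) : 0 ≤ meanExpRemainder t :=
  intervalIntegral.integral_nonneg zero_le_one fun _ hw =>
    expRemainder_nonneg (mul_nonneg ht hw.1)

theorem meanExpRemainder_le_one {t : ℝ} (ht : 0 ≤ t) : meanExpRemainder t ≤ 1 := by
  have := intervalIntegral.integral_mono_on zero_le_one (intervalIntegrable_expRemainder_mul ht)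
    (intervalIntegrable_const (c := (1 : ℝ)))
    fun w hw => expRemainder_le_one (mul_nonneg ht hw.1)
  simpa [meanExpRemainder] using this

theorem monotoneOn_meanExpRemainder : MonotoneOn meanExpRemainder (Ici 0) := fun _ hs _ ht hst =>
  intervalIntegral.integral_mono_on zero_le_one (intervalIntegrable_expRemainder_mul hs)
    (intervalIntegrable_expRemainder_mul ht) fun _ hw =>
      monotoneOn_expRemainder (mul_nonneg hs hw.1) (mul_nonneg ht hw.1)
        (mul_le_mul_of_nonneg_right hst hw.1)

/-- The factor 1 - w is split and x = tw substituted: the first integral carries the logarithmic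
growth, while the mean stays in [0, 1]. -/
theorem comparisonRate_eq {t : ℝ} (ht : 0 < t) : comparisonRate t =
    2 * (∫ x in (0 : ℝ)..t, expRemainder x / x) - 2 * meanExpRemainder t := by
  have hsub := intervalIntegral.mul_integral_comp_mul_left (a := 0) (b := 1)
    (f := fun x => expRemainder x / x) (c := t)
  rw [mul_zero, mul_one] at hsub
  have hint := intervalIntegrable_expRemainder_div le_rfl ht.le
  have hint' : IntervalIntegrable (fun w => expRemainder (t * w) / (t * w)) volume 0 1 := by
    have := hint.comp_mul_left (c := t)
    simpa [ht.ne'] using this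
  rw [comparisonRate, poissonComparisons, ← intervalIntegral.integral_of_le zero_le_one, ← hsub,
    meanExpRemainder, ← intervalIntegral.integral_const_mul,
    ← intervalIntegral.integral_const_mul, ← intervalIntegral.integral_const_mul,
    ← intervalIntegral.integral_sub ((hint'.const_mul t).const_mul 2)
      ((intervalIntegrable_expRemainder_mul ht.le).const_mul 2), ← intervalIntegral.integral_div]
  refine intervalIntegral.integral_congr fun w _ => ?_
  simp only [comparisonKernel, expRemainder]
  rcases eq_or_ne w 0 with rfl | hw
  · simp
  field_simp

theorem comparisonRate_sub_eq {s t : ℝ} (hs : 0 < s) (hst : s ≤ t) :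
    comparisonRate t - comparisonRate s = 2 * (∫ x in s..t, expRemainder x / x) -
      2 * (meanExpRemainder t - meanExpRemainder s) := by
  rw [comparisonRate_eq hs, comparisonRate_eq (hs.trans_le hst),
    ← intervalIntegral.integral_add_adjacent_intervals
      (intervalIntegrable_expRemainder_div le_rfl hs.le)
      (intervalIntegrable_expRemainder_div hs.le hst)]
  ring

theorem comparisonRate_sub_le {s t : ℝ} (hs : 0 < s) (hst : s ≤ t) :
    comparisonRate t - comparisonRate s ≤ 2 * Real.log (t / s) := by
  have ht : 0 < t := hs.trans_le hst
  have hm := monotoneOn_meanExpRemainder hs.le ht.le hst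
  have hi : ∫ x in s..t, expRemainder x / x ≤ ∫ x in s..t, 1 / x := by
    refine intervalIntegral.integral_mono_on hst (intervalIntegrable_expRemainder_div hs.le hst)
      ?_ fun x hx => ?_
    · exact intervalIntegral.intervalIntegrable_one_div
        (fun x hx => by rw [uIcc_of_le hst] at hx; exact (hs.trans_le hx.1).ne') continuousOn_id
    · have hx0 : 0 < x := hs.trans_le hx.1
      exact div_le_div_of_nonneg_right (expRemainder_le_one hx0.le) hx0.le
  rw [integral_one_div_of_pos hs ht] at hi
  rw [comparisonRate_sub_eq hs hst]
  linarith

/-- Replacing `expRemainder x` by 1 - 1/x costs at most 2/s. The increment of `meanExpRemainder` is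
kept, because its sum over the ranks nearly telescopes; bounding it by a constant at each rank would
be too costly. -/
theorem le_comparisonRate_sub {s t : ℝ} (hs : 0 < s) (hst : s ≤ t) :
    2 * Real.log (t / s) - 2 / s - 2 * (meanExpRemainder t - meanExpRemainder s) ≤
      comparisonRate t - comparisonRate s := by
  have ht : 0 < t := hs.trans_le hst
  have hne : ∀ x ∈ uIcc s t, x ≠ 0 := fun x hx => by
    rw [uIcc_of_le hst] at hx
    exact (hs.trans_le hx.1).ne'
  have h1 : IntervalIntegrable (fun x : ℝ => 1 / x) volume s t :=
    intervalIntegral.intervalIntegrable_one_div hne continuousOn_id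
  have h2 : IntervalIntegrable (fun x : ℝ => x ^ (-2 : ℤ)) volume s t :=
    intervalIntegral.intervalIntegrable_zpow (Or.inr fun h => hne 0 h rfl)
  have hi : ∫ x in s..t, (1 / x - x ^ (-2 : ℤ)) ≤ ∫ x in s..t, expRemainder x / x := by
    refine intervalIntegral.integral_mono_on hst (h1.sub h2)
      (intervalIntegrable_expRemainder_div hs.le hst) fun x hx => ?_
    have hx0 : 0 < x := hs.trans_le hx.1
    rw [le_div_iff₀ hx0]
    refine le_trans (le_of_eq ?_) (one_sub_inv_le_expRemainder hx0)
    rw [zpow_neg]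
    field_simp
  rw [intervalIntegral.integral_sub h1 h2, integral_one_div_of_pos hs ht,
    integral_zpow (Or.inr ⟨by norm_num, fun h => hne 0 h rfl⟩)] at hi
  norm_num at hi
  have hti : 0 < t⁻¹ := by positivity
  rw [comparisonRate_sub_eq hs hst, div_eq_mul_inv 2 s]
  linarith

end Growth

/-! ### Growth of the bit comparisons per key -/

section BitRate

/-- The mean number of bit comparisons per key, for a Poisson number of mean `t` of uniform keys. -/
noncomputable def bitRate (t : ℝ) : ℝ := ∑' k : ℕ, comparisonRate (t / 2 ^ k)

theorem comparisonRate_div_two_pow_le {t : ℝ} (ht : 0 ≤ t) (k : ℕ) :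
    comparisonRate (t / 2 ^ k) ≤ 2 * t * (1 / 2) ^ k := by
  refine (comparisonRate_le (by positivity)).trans (le_of_eq ?_)
  rw [one_div, inv_pow]
  ring

theorem summable_comparisonRate {t : ℝ} (ht : 0 ≤ t) :
    Summable fun k : ℕ => comparisonRate (t / 2 ^ k) :=
  Summable.of_nonneg_of_le (fun k => comparisonRate_nonneg (by positivity))
    (comparisonRate_div_two_pow_le ht) (summable_geometric_two.mul_left _)

theorem bitRate_nonneg {t : ℝ} (ht : 0 ≤ t) : 0 ≤ bitRate t :=
  tsum_nonneg fun k => comparisonRate_nonneg (by positivity)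

@[simp] theorem bitRate_zero : bitRate 0 = 0 := by simp [bitRate, comparisonRate]

theorem bitRate_le {t : ℝ} (ht : 0 ≤ t) : bitRate t ≤ 4 * t := by
  refine ((summable_comparisonRate ht).tsum_le_tsum (comparisonRate_div_two_pow_le ht)
    (summable_geometric_two.mul_left _)).trans (le_of_eq ?_)
  rw [tsum_mul_left, tsum_geometric_two]
  ring

theorem bitRate_eq_sum_add {t : ℝ} (ht : 0 ≤ t) (n : ℕ) :
    bitRate t = ∑ k ∈ Finset.range n, comparisonRate (t / 2 ^ k) + bitRate (t / 2 ^ n) := by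
  rw [bitRate, ← (summable_comparisonRate ht).sum_add_tsum_nat_add n, bitRate]
  congr 1
  refine tsum_congr fun k => ?_
  rw [div_div, ← pow_add, add_comm n k]

theorem monotoneOn_bitRate : MonotoneOn bitRate (Ici 0) := fun _ hs _ ht hst =>
  (summable_comparisonRate hs).tsum_le_tsum
    (fun _ => monotoneOn_comparisonRate (mem_Ici.2 (div_nonneg hs (by positivity)))
      (mem_Ici.2 (div_nonneg ht (by positivity))) (by gcongr)) (summable_comparisonRate ht)

theorem measurable_bitRate : Measurable bitRate := by
  have hc : Measurable comparisonRate :=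
    continuous_poissonComparisons.measurable.div measurable_id
  exact Measurable.tsum fun k => hc.comp (measurable_id.div_const _)

theorem exists_two_pow_near_logb {t : ℝ} (ht : 1 ≤ t) : ∃ n : ℕ, t < 2 ^ n ∧ 2 ^ n ≤ 2 * t ∧
    (n : ℝ) ≤ Real.logb 2 t + 1 ∧ Real.logb 2 t ≤ n := by
  obtain ⟨n, h1, h2⟩ := exists_nat_pow_near ht one_lt_two
  have ht0 : 0 < t := zero_lt_one.trans_le ht
  refine ⟨n + 1, h2, by rw [pow_succ]; linarith, ?_, ?_⟩
  · push_cast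
    gcongr
    rw [Real.le_logb_iff_rpow_le one_lt_two ht0]
    exact_mod_cast h1
  · rw [Real.logb_le_iff_le_rpow one_lt_two ht0]
    exact_mod_cast h2.le

/-- With n close to lg t, each of the first n ranks contributes at most 2 log (t / s); beyond them
the argument is below 1 and the tail is at most 4. -/
theorem bitRate_sub_le {s t : ℝ} (hs : 0 < s) (hst : s ≤ t) (ht : 1 ≤ t) :
    bitRate t - bitRate s ≤ 2 * Real.log (t / s) * (Real.logb 2 t + 1) + 4 := by
  have ht0 : 0 < t := hs.trans_le hst
  obtain ⟨n, h1, -, h2, -⟩ := exists_two_pow_near_logb ht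
  have hlog : 0 ≤ Real.log (t / s) := Real.log_nonneg ((one_le_div hs).2 hst)
  rw [bitRate_eq_sum_add ht0.le n, bitRate_eq_sum_add hs.le n]
  have hsum : ∑ k ∈ Finset.range n, comparisonRate (t / 2 ^ k) -
      ∑ k ∈ Finset.range n, comparisonRate (s / 2 ^ k) ≤ n * (2 * Real.log (t / s)) := by
    rw [← Finset.sum_sub_distrib]
    refine (Finset.sum_le_card_nsmul _ _ (2 * Real.log (t / s)) fun k _ => ?_).trans_eq (by simp)
    refine (comparisonRate_sub_le (by positivity) (by gcongr)).trans_eq ?_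
    rw [div_div_div_cancel_right₀ (by positivity)]
  have htail : bitRate (t / 2 ^ n) ≤ 4 := by
    refine (bitRate_le (by positivity)).trans ?_
    have : t / 2 ^ n ≤ 1 := (div_le_one (by positivity)).2 h1.le
    linarith
  have h0 : 0 ≤ bitRate (s / 2 ^ n) := bitRate_nonneg (by positivity)
  have h3 : n * (2 * Real.log (t / s)) ≤ (Real.logb 2 t + 1) * (2 * Real.log (t / s)) := by
    gcongr
  linarith

/-- When t = 2s the sum telescopes and is at most 1, since the means lie in [0, 1]. The general case
takes j doublings, and the bound does not depend on n. -/
theorem sum_meanExpRemainder_sub_le {s t : ℝ} (hs : 0 < s) (ht : 0 < t) (j : ℕ)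
    (htj : t ≤ 2 ^ j * s) (n : ℕ) : ∑ k ∈ Finset.range n,
      (meanExpRemainder (t / 2 ^ k) - meanExpRemainder (s / 2 ^ k)) ≤ j := by
  have hmono : ∑ k ∈ Finset.range n, (meanExpRemainder (t / 2 ^ k) - meanExpRemainder (s / 2 ^ k)) ≤
      ∑ k ∈ Finset.range n,
        (meanExpRemainder (2 ^ j * s / 2 ^ k) - meanExpRemainder (s / 2 ^ k)) := by
    gcongr with k
    exact monotoneOn_meanExpRemainder (mem_Ici.2 (by positivity)) (mem_Ici.2 (by positivity))
      (by gcongr)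
  refine hmono.trans ?_
  clear hmono htj
  induction j with
  | zero => simp
  | succ j ih =>
    have htel : ∑ k ∈ Finset.range n, (meanExpRemainder (2 ^ (j + 1) * s / 2 ^ k) -
        meanExpRemainder (2 ^ j * s / 2 ^ k)) ≤ 1 := by
      have := Finset.sum_range_sub' (fun k : ℕ => meanExpRemainder (2 ^ (j + 1) * s / 2 ^ k)) n
      have hk : ∀ k : ℕ, 2 ^ (j + 1) * s / 2 ^ (k + 1) = 2 ^ j * s / 2 ^ k := by
        intro k
        field_simp
        ring
      simp only [hk] at this
      rw [this]
      have h1 : meanExpRemainder (2 ^ (j + 1) * s / 2 ^ 0) ≤ 1 :=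
        meanExpRemainder_le_one (by positivity)
      have h2 : 0 ≤ meanExpRemainder (2 ^ (j + 1) * s / 2 ^ n) :=
        meanExpRemainder_nonneg (by positivity)
      linarith
    rw [Finset.sum_sub_distrib] at htel ih ⊢
    push_cast
    linarith

/-- At rank k < n the error 2/s becomes 2 · 2^k / s; as 2 ^ n ≤ 2s, these errors sum to at most 4.
The increments of the means cost at most 2j. -/
theorem le_bitRate_sub {s t : ℝ} (hs : 1 ≤ s) (hst : s ≤ t) (j : ℕ) (htj : t ≤ 2 ^ j * s) :
    2 * Real.log (t / s) * Real.logb 2 s - 4 - 2 * j ≤ bitRate t - bitRate s := by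
  have hs0 : 0 < s := zero_lt_one.trans_le hs
  have ht0 : 0 < t := hs0.trans_le hst
  obtain ⟨n, -, h1, -, h2⟩ := exists_two_pow_near_logb hs
  have hlog : 0 ≤ Real.log (t / s) := Real.log_nonneg ((one_le_div hs0).2 hst)
  rw [bitRate_eq_sum_add ht0.le n, bitRate_eq_sum_add hs0.le n]
  have htail : bitRate (s / 2 ^ n) ≤ bitRate (t / 2 ^ n) :=
    monotoneOn_bitRate (mem_Ici.2 (by positivity)) (mem_Ici.2 (by positivity)) (by gcongr)
  have hsum : ∑ k ∈ Finset.range n, (2 * Real.log (t / s) - 2 / s * 2 ^ k -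
      2 * (meanExpRemainder (t / 2 ^ k) - meanExpRemainder (s / 2 ^ k))) ≤
      ∑ k ∈ Finset.range n, comparisonRate (t / 2 ^ k) -
      ∑ k ∈ Finset.range n, comparisonRate (s / 2 ^ k) := by
    rw [← Finset.sum_sub_distrib]
    refine Finset.sum_le_sum fun k _ => ?_
    refine le_trans (le_of_eq ?_) (le_comparisonRate_sub (by positivity) (by gcongr))
    rw [div_div_div_cancel_right₀ (by positivity)]
    field_simp
  rw [Finset.sum_sub_distrib, Finset.sum_sub_distrib, Finset.sum_const, Finset.card_range,
    nsmul_eq_mul, ← Finset.mul_sum, ← Finset.mul_sum, geom_sum_eq (by norm_num)] at hsum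
  have hgeom : 2 / s * (((2 : ℝ) ^ n - 1) / (2 - 1)) ≤ 4 := by
    rw [div_mul_eq_mul_div, div_le_iff₀ hs0]
    norm_num
    linarith
  have hrem := sum_meanExpRemainder_sub_le hs0 ht0 j htj n
  have h3 : Real.logb 2 s * (2 * Real.log (t / s)) ≤ n * (2 * Real.log (t / s)) := by
    gcongr
  linarith

theorem exists_abs_bitRate_mul_sub_le_of_one_le {u : ℝ} (hu : 1 ≤ u) :
    ∃ C, ∀ x, 1 ≤ x →
      |bitRate (u * x) - bitRate x - 2 * Real.logb 2 u * Real.log x| ≤ C := by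
  have hu0 : 0 < u := zero_lt_one.trans_le hu
  obtain ⟨j, hj⟩ := pow_unbounded_of_one_lt u one_lt_two
  refine ⟨4 + 2 * j + 2 * Real.log u * (Real.logb 2 u + 1), fun x hx => ?_⟩
  have hx0 : 0 < x := zero_lt_one.trans_le hx
  have hxu : x ≤ u * x := by nlinarith
  have h1 := le_bitRate_sub hx hxu j (by gcongr)
  have h2 := bitRate_sub_le hx0 hxu (hx.trans hxu)
  rw [mul_div_cancel_right₀ _ hx0.ne'] at h1 h2
  rw [Real.logb_mul hu0.ne' hx0.ne'] at h2
  -- This swap of bases turns lg x ranks of gain 2 ln u each into the main term 2 lg u · ln x.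
  have h3 : Real.log u * Real.logb 2 x = Real.logb 2 u * Real.log x := by
    simp only [Real.logb]
    ring
  have h4 : 0 ≤ Real.log u * (Real.logb 2 u + 1) :=
    mul_nonneg (Real.log_nonneg hu) (add_nonneg (Real.logb_nonneg one_lt_two hu) zero_le_one)
  have h5 : (0 : ℝ) ≤ j := Nat.cast_nonneg j
  rw [abs_le]
  constructor <;> linarith

theorem exists_abs_bitRate_mul_sub_le {u : ℝ} (hu : 0 < u) :
    ∃ C, ∀ᶠ x in atTop,
      |bitRate (u * x) - bitRate x - 2 * Real.logb 2 u * Real.log x| ≤ C := by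
  rcases le_total 1 u with h1 | h1
  · obtain ⟨C, hC⟩ := exists_abs_bitRate_mul_sub_le_of_one_le h1
    exact ⟨C, (eventually_ge_atTop 1).mono hC⟩
  · obtain ⟨C, hC⟩ := exists_abs_bitRate_mul_sub_le_of_one_le ((one_le_inv₀ hu).2 h1)
    refine ⟨C + |2 * Real.logb 2 u * Real.log u|, ?_⟩
    filter_upwards [eventually_ge_atTop u⁻¹, eventually_gt_atTop 0] with x hx hx0
    -- For u ≤ 1 the previous case is applied to the factor u⁻¹ at the point ux.
    have h2 := hC (u * x) (by rwa [inv_le_iff_one_le_mul₀' hu] at hx)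
    rw [inv_mul_cancel_left₀ hu.ne', Real.logb_inv, Real.log_mul hu.ne' hx0.ne'] at h2
    have h3 : bitRate (u * x) - bitRate x - 2 * Real.logb 2 u * Real.log x =
      -(bitRate x - bitRate (u * x) - 2 * -Real.logb 2 u * (Real.log u + Real.log x)) +
        2 * Real.logb 2 u * Real.log u := by ring
    rw [h3]
    refine (abs_add_le _ _).trans ?_
    rw [abs_neg]
    gcongr

theorem tendsto_bitRate_mul_sub_div_log {u : ℝ} (hu : 0 < u) :
    Tendsto (fun x => (bitRate (u * x) - bitRate x) / Real.log x) atTop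
      (nhds (2 * Real.logb 2 u)) := by
  obtain ⟨C, hC⟩ := exists_abs_bitRate_mul_sub_le hu
  have h0 : Tendsto (fun x => C / Real.log x) atTop (nhds 0) :=
    Real.tendsto_log_atTop.const_div_atTop C
  refine tendsto_iff_norm_sub_tendsto_zero.2
    (squeeze_zero' (Eventually.of_forall fun _ => norm_nonneg _) ?_ h0)
  filter_upwards [hC, eventually_gt_atTop 1] with x hx hx1
  have hlog : 0 < Real.log x := Real.log_pos hx1
  rw [div_sub' hlog.ne', norm_div, Real.norm_of_nonneg hlog.le, Real.norm_eq_abs]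
  gcongr
  rwa [mul_comm (Real.log x)]

/-- After division by log x the bound is independent of x, as dominated convergence requires. From x
≥ e, log x ≥ 1 absorbs the constants; the square comes from log u · lg(ux) when u ≥ 1. -/
theorem abs_bitRate_mul_sub_le {u x : ℝ} (hu : 0 < u) (hx : Real.exp 1 ≤ x) :
    |bitRate (u * x) - bitRate x| ≤
      Real.log x * (4 + 6 * |Real.log u| + 4 * Real.posLog u ^ 2) := by
  have hx1 : 1 ≤ x := (Real.one_le_exp zero_le_one).trans hx
  have hx0 : 0 < x := zero_lt_one.trans_le hx1
  have hlog : 1 ≤ Real.log x := by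
    rwa [Real.le_log_iff_exp_le hx0]
  have hl2 : 1 / Real.log 2 ≤ 2 := by
    rw [div_le_iff₀ (Real.log_pos one_lt_two)]
    linarith [Real.log_two_gt_d9]
  have hlogb : ∀ y, 1 ≤ y → Real.logb 2 y ≤ 2 * Real.log y := by
    intro y hy
    rw [Real.logb, div_eq_mul_one_div, mul_comm]
    exact mul_le_mul_of_nonneg_right hl2 (Real.log_nonneg hy)
  have h2x := hlogb x hx1
  rcases le_total 1 u with h1 | h1
  · have hxu : x ≤ u * x := by nlinarith
    have hm := monotoneOn_bitRate hx0.le (hx0.trans_le hxu).le hxu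
    have h2 := bitRate_sub_le hx0 hxu (hx1.trans hxu)
    have hu2 := hlogb u h1
    have hlu : 0 ≤ Real.log u := Real.log_nonneg h1
    rw [mul_div_cancel_right₀ _ hx0.ne', Real.logb_mul hu.ne' hx0.ne'] at h2
    rw [abs_of_nonneg (sub_nonneg.2 hm), abs_of_nonneg hlu,
      Real.posLog_eq_log (by rwa [abs_of_pos hu])]
    refine h2.trans ?_
    have h3 : 2 * Real.log u * (Real.logb 2 u + Real.logb 2 x + 1) ≤
        2 * Real.log u * (2 * Real.log u + 2 * Real.log x + 1) := by gcongr
    nlinarith [mul_nonneg hlu hlu, mul_nonneg (sub_nonneg.2 hlog) hlu,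
      mul_nonneg (sub_nonneg.2 hlog) (mul_nonneg hlu hlu)]
  · have hxu : u * x ≤ x := by nlinarith
    have hux0 : 0 < u * x := by positivity
    have hm := monotoneOn_bitRate hux0.le hx0.le hxu
    have h2 := bitRate_sub_le hux0 hxu hx1
    have hlu : 0 ≤ -Real.log u := by linarith [Real.log_nonpos hu.le h1]
    rw [div_mul_cancel_right₀ hx0.ne', Real.log_inv] at h2
    rw [abs_sub_comm, abs_of_nonneg (sub_nonneg.2 hm), abs_of_nonpos (by linarith)]
    refine h2.trans ?_
    have h3 : 2 * -Real.log u * (Real.logb 2 x + 1) ≤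
        2 * -Real.log u * (2 * Real.log x + 1) := by gcongr
    have h4 : 0 ≤ Real.log x * (4 * Real.posLog u ^ 2) := by positivity
    nlinarith [mul_nonneg (sub_nonneg.2 hlog) hlu]

end BitRate

/-! ### Masses of cells, lower bounds by convexity, and uniform keys -/

section Cells

/-- The mass of the `j`th dyadic cell of rank `k`. -/
noncomputable def cellMass (F : Measure ℝ) (k j : ℕ) : ℝ := F.real {x | dyadicIndex k x = j}

theorem cellMass_nonneg (F : Measure ℝ) (k j : ℕ) : 0 ≤ cellMass F k j := measureReal_nonneg

theorem measurableSet_dyadicIndex_eq (k j : ℕ) : MeasurableSet {x | dyadicIndex k x = j} :=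
  measurable_dyadicIndex k (measurableSet_singleton j)

theorem cellMass_eq_add (F : Measure ℝ) [IsFiniteMeasure F] (k j : ℕ) :
    cellMass F k j = cellMass F (k + 1) (2 * j) + cellMass F (k + 1) (2 * j + 1) := by
  rw [cellMass, cellMass, cellMass, ← measureReal_union _ (measurableSet_dyadicIndex_eq _ _)]
  · congr 1
    ext x
    simp only [mem_ofPred_eq, mem_union, ← dyadicIndex_succ_div k x]
    omega
  · rw [Set.disjoint_left]
    intro x hx hx'
    simp only [mem_ofPred_eq] at hx hx'
    omega

theorem sum_range_two_mul (a : ℕ → ℝ) (n : ℕ) :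
    ∑ j ∈ Finset.range (2 * n), a j = ∑ j ∈ Finset.range n, (a (2 * j) + a (2 * j + 1)) := by
  induction n with
  | zero => simp
  | succ n ih =>
    rw [Nat.mul_succ, Finset.sum_range_succ, Finset.sum_range_succ, ih, Finset.sum_range_succ]
    ring

/-- Refining the partition into dyadic cells increases sums of convex functions of the masses. -/
theorem two_pow_mul_sum_cellMass_le (F : Measure ℝ) [IsFiniteMeasure F] {φ : ℝ → ℝ}
    (hφ : ConvexOn ℝ univ φ) (K i : ℕ) :
    2 ^ i * ∑ j ∈ Finset.range (2 ^ K), φ (cellMass F K j / 2 ^ i) ≤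
      ∑ j ∈ Finset.range (2 ^ (K + i)), φ (cellMass F (K + i) j) := by
  induction i generalizing K with
  | zero => simp
  | succ i ih =>
    -- Starting from rank K + 1, it remains to merge the two halves of each cell of rank K by
    -- midpoint convexity.
    have h := ih (K + 1)
    rw [show K + 1 + i = K + (i + 1) by ring] at h
    refine le_trans ?_ h
    rw [pow_succ (2 : ℕ) K, mul_comm (2 ^ K) 2, sum_range_two_mul, pow_succ (2 : ℝ) i, mul_assoc,
      Finset.mul_sum]
    gcongr with j
    have hc := hφ.2 (mem_univ (cellMass F (K + 1) (2 * j) / 2 ^ i))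
      (mem_univ (cellMass F (K + 1) (2 * j + 1) / 2 ^ i))
      (one_half_pos (α := ℝ)).le (one_half_pos (α := ℝ)).le (add_halves 1)
    have he : cellMass F K j / (2 ^ i * 2) = (1 / 2 : ℝ) • (cellMass F (K + 1) (2 * j) / 2 ^ i) +
        (1 / 2 : ℝ) • (cellMass F (K + 1) (2 * j + 1) / 2 ^ i) := by
      rw [cellMass_eq_add]
      simp only [smul_eq_mul]
      field_simp
    rw [he]
    simp only [smul_eq_mul] at hc ⊢
    linarith

theorem cellMass_zero_zero (F : Measure ℝ) [IsProbabilityMeasure F]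
    (hF : ∀ᵐ x ∂F, x ∈ Ico (0 : ℝ) 1) : cellMass F 0 0 = 1 := by
  have : F {x | dyadicIndex 0 x = 0} = F univ := by
    refine measure_congr ?_
    filter_upwards [hF] with x hx
    have := dyadicIndex_lt hx 0
    rw [pow_zero, Nat.lt_one_iff] at this
    exact eq_true this
  rw [cellMass, measureReal_def, this]
  simp

theorem convexOn_poissonComparisons_mul (c : ℝ) :
    ConvexOn ℝ univ fun x => poissonComparisons (c * x) := by
  refine ⟨convex_univ, fun x _ y _ a b ha hb hab => ?_⟩
  have := convexOn_poissonComparisons.2 (mem_univ (c * x)) (mem_univ (c * y)) ha hb hab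
  simp only [smul_eq_mul] at this ⊢
  convert! this using 2
  ring

/-- The mean number of comparisons of `k`th bits. -/
noncomputable def levelComparisons (F : Measure ℝ) (lam : ℝ) (k : ℕ) : ℝ :=
  ∑ j ∈ Finset.range (2 ^ k), poissonComparisons (lam * cellMass F k j)

theorem levelComparisons_nonneg (F : Measure ℝ) (lam : ℝ) (k : ℕ) :
    0 ≤ levelComparisons F lam k :=
  Finset.sum_nonneg fun _ _ => poissonComparisons_nonneg _

theorem meanBits_eq_tsum_levelComparisons (F : Measure ℝ) [IsProbabilityMeasure F]
    [NullSingletonClass F] (hF : ∀ᵐ x ∂F, x ∈ Ico (0 : ℝ) 1) (lam : ℝ≥0) :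
    meanBits F lam = ∑' k, ENNReal.ofReal (levelComparisons F lam k) := by
  rw [meanBits_eq_tsum F hF]
  refine tsum_congr fun k => ?_
  rw [levelComparisons, ENNReal.ofReal_sum_of_nonneg fun _ _ => poissonComparisons_nonneg _]
  refine Finset.sum_congr rfl fun j _ => ?_
  rw [lintegral_meanComparisons_poissonMeasure]
  rfl

/-- The left side is the value at rank K + i if the mass of each cell of rank K were divided equally
among its 2 ^ i subcells. -/
theorem le_levelComparisons_add (F : Measure ℝ) [IsFiniteMeasure F] (lam : ℝ) (K i : ℕ) :
    ∑ j ∈ Finset.range (2 ^ K),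
      lam * cellMass F K j * comparisonRate (lam * cellMass F K j / 2 ^ i) ≤
      levelComparisons F lam (K + i) := by
  refine le_trans (le_of_eq ?_)
    (two_pow_mul_sum_cellMass_le F (convexOn_poissonComparisons_mul lam) K i)
  rw [Finset.mul_sum]
  refine Finset.sum_congr rfl fun j _ => ?_
  rw [← mul_div_assoc, ← mul_comparisonRate]
  field_simp

theorem le_levelComparisons (F : Measure ℝ) [IsProbabilityMeasure F]
    (hF : ∀ᵐ x ∂F, x ∈ Ico (0 : ℝ) 1) (lam : ℝ) (k : ℕ) :
    lam * comparisonRate (lam / 2 ^ k) ≤ levelComparisons F lam k := by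
  have := le_levelComparisons_add F lam 0 k
  simpa [cellMass_zero_zero F hF] using this

/-- A lower bound obtained by spreading the keys evenly within the cells of rank `K`. -/
theorem le_tsum_levelComparisons (F : Measure ℝ) [IsProbabilityMeasure F]
    (hF : ∀ᵐ x ∂F, x ∈ Ico (0 : ℝ) 1) {lam : ℝ} (hlam : 0 ≤ lam)
    (hs : Summable (levelComparisons F lam)) (K : ℕ) :
    lam * (bitRate lam - bitRate (lam / 2 ^ K)) +
      ∑ j ∈ Finset.range (2 ^ K), lam * cellMass F K j * bitRate (lam * cellMass F K j) ≤
      ∑' k, levelComparisons F lam k := by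
  -- The difference `bitRate lam - bitRate (lam / 2 ^ K)` is the sum of the first K rates, which
  -- bound the ranks below K.
  rw [← hs.sum_add_tsum_nat_add K, bitRate_eq_sum_add hlam K, add_sub_cancel_right, Finset.mul_sum]
  have hp : ∀ j, 0 ≤ lam * cellMass F K j := fun j => mul_nonneg hlam (cellMass_nonneg F K j)
  refine add_le_add (Finset.sum_le_sum fun k _ => le_levelComparisons F hF lam k) ?_
  simp_rw [bitRate, ← tsum_mul_left]
  rw [← Summable.tsum_finsetSum fun j _ => (summable_comparisonRate (hp j)).mul_left _]
  refine Summable.tsum_le_tsum (fun i => ?_)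
    (summable_sum fun j _ => (summable_comparisonRate (hp j)).mul_left _)
    ((summable_nat_add_iff K).2 hs)
  rw [add_comm i K]
  exact le_levelComparisons_add F lam K i

theorem unifDist_eq : unifDist = volume.restrict (Ico 0 1) :=
  Measure.restrict_congr_set Ioo_ae_eq_Ico

theorem unifDist_eq_densityDist : unifDist = densityDist fun _ => 1 := by
  simp [densityDist]

theorem dyadicIndex_eq_iff {x : ℝ} (hx : 0 ≤ x) (k j : ℕ) :
    dyadicIndex k x = j ↔ x ∈ Ico ((j : ℝ) / 2 ^ k) ((j + 1) / 2 ^ k) := by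
  rw [dyadicIndex, Nat.floor_eq_iff (by positivity), mem_Ico, div_le_iff₀ (by positivity),
    lt_div_iff₀ (by positivity), mul_comm]

theorem setOf_dyadicIndex_eq_inter_Ico {k j : ℕ} (hj : j < 2 ^ k) :
    {x | dyadicIndex k x = j} ∩ Ico 0 1 = Ico ((j : ℝ) / 2 ^ k) ((j + 1) / 2 ^ k) := by
  ext x
  constructor
  · rintro ⟨h, hx⟩
    exact (dyadicIndex_eq_iff hx.1 k j).1 h
  · intro h
    have h0 : 0 ≤ x := le_trans (by positivity) h.1
    refine ⟨(dyadicIndex_eq_iff h0 k j).2 h, h0, h.2.trans_le ?_⟩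
    rw [div_le_one (by positivity)]
    exact_mod_cast hj

theorem cellMass_densityDist {f : ℝ → ℝ} (hf : Measurable f) (hf0 : 0 ≤ f) {k j : ℕ}
    (hj : j < 2 ^ k) : cellMass (densityDist f) k j =
      ∫ x in Ico ((j : ℝ) / 2 ^ k) ((j + 1) / 2 ^ k), f x := by
  rw [cellMass, measureReal_def, densityDist,
    withDensity_apply _ (measurableSet_dyadicIndex_eq k j), unifDist_eq,
    Measure.restrict_restrict (measurableSet_dyadicIndex_eq k j),
    setOf_dyadicIndex_eq_inter_Ico hj,
    integral_eq_lintegral_of_nonneg_ae (ae_of_all _ hf0) hf.aestronglyMeasurable]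

theorem densityDist_absolutelyContinuous (f : ℝ → ℝ) : densityDist f ≪ volume :=
  (withDensity_absolutelyContinuous _ _).trans Measure.absolutelyContinuous_restrict

theorem ae_mem_Ico_densityDist (f : ℝ → ℝ) : ∀ᵐ x ∂(densityDist f), x ∈ Ico (0 : ℝ) 1 := by
  refine (withDensity_absolutelyContinuous _ _).ae_le ?_
  rw [unifDist_eq]
  exact ae_restrict_mem measurableSet_Ico

instance nullSingletonClass_densityDist (f : ℝ → ℝ) : NullSingletonClass (densityDist f) :=
  ⟨fun _ => densityDist_absolutelyContinuous f (measure_singleton _)⟩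

theorem isProbabilityMeasure_densityDist {f : ℝ → ℝ}
    (hf : ∫⁻ x in Ioo (0 : ℝ) 1, ENNReal.ofReal (f x) = 1) :
    IsProbabilityMeasure (densityDist f) :=
  ⟨by rw [densityDist, withDensity_apply _ MeasurableSet.univ, Measure.restrict_univ, unifDist, hf]⟩

theorem levelComparisons_unifDist (lam : ℝ) (k : ℕ) :
    levelComparisons unifDist lam k = lam * comparisonRate (lam / 2 ^ k) := by
  have hmass : ∀ j ∈ Finset.range (2 ^ k), poissonComparisons (lam * cellMass unifDist k j) =
      lam / 2 ^ k * comparisonRate (lam / 2 ^ k) := by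
    intro j hj
    rw [unifDist_eq_densityDist, cellMass_densityDist measurable_const (fun _ => zero_le_one)
      (Finset.mem_range.1 hj), mul_comparisonRate]
    have : ((j : ℝ) + 1) / 2 ^ k - j / 2 ^ k = 1 / 2 ^ k := by ring
    rw [setIntegral_const, smul_eq_mul, mul_one, Real.volume_real_Ico_of_le (by gcongr; simp), this,
      mul_one_div]
  rw [levelComparisons, Finset.sum_congr rfl hmass]
  simp
  field_simp

instance isProbabilityMeasure_unifDist : IsProbabilityMeasure unifDist := by
  rw [unifDist_eq_densityDist]
  exact isProbabilityMeasure_densityDist (by simp)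

theorem ofReal_mul_bitRate {t : ℝ} (ht : 0 ≤ t) : ENNReal.ofReal (t * bitRate t) =
    ∑' k : ℕ, ENNReal.ofReal (t * comparisonRate (t / 2 ^ k)) := by
  rw [bitRate, ← tsum_mul_left, ENNReal.ofReal_tsum_of_nonneg
    (fun k => mul_nonneg ht (comparisonRate_nonneg (div_nonneg ht (by positivity))))
    ((summable_comparisonRate ht).mul_left _)]

theorem meanBits_unifDist (lam : ℝ≥0) :
    meanBits unifDist lam = ENNReal.ofReal (lam * bitRate lam) := by
  have : NullSingletonClass unifDist := by
    rw [unifDist_eq_densityDist]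
    infer_instance
  rw [meanBits_eq_tsum_levelComparisons unifDist
    (by rw [unifDist_eq_densityDist]; exact ae_mem_Ico_densityDist _),
    ofReal_mul_bitRate lam.coe_nonneg]
  simp_rw [levelComparisons_unifDist]

theorem meanBits_unifDist_le (F : Measure ℝ) [IsProbabilityMeasure F] [NullSingletonClass F]
    (hF : ∀ᵐ x ∂F, x ∈ Ico (0 : ℝ) 1) (lam : ℝ≥0) : meanBits unifDist lam ≤ meanBits F lam := by
  rw [meanBits_unifDist, ofReal_mul_bitRate lam.coe_nonneg,
    meanBits_eq_tsum_levelComparisons F hF]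
  exact ENNReal.tsum_le_tsum fun k => ENNReal.ofReal_le_ofReal (le_levelComparisons F hF lam k)

end Cells

/-! ### Upper bound by Jensen's inequality, and dominated convergence -/

section UpperBound

theorem sum_setIntegral_dyadic {φ : ℝ → ℝ} (hφ : IntegrableOn φ (Ico 0 1)) (k : ℕ) :
    ∑ j ∈ Finset.range (2 ^ k), ∫ x in Ico ((j : ℝ) / 2 ^ k) ((j + 1) / 2 ^ k), φ x =
      ∫ x in Ico 0 1, φ x := by
  have h01 : IntervalIntegrable φ volume 0 1 := by
    rwa [intervalIntegrable_iff_integrableOn_Ico_of_le zero_le_one]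
  have hle : ∀ j : ℕ, (j : ℝ) / 2 ^ k ≤ (j + 1) / 2 ^ k := fun j => by gcongr; simp
  have h := intervalIntegral.sum_integral_adjacent_intervals (f := φ) (μ := volume)
    (a := fun j : ℕ => (j : ℝ) / 2 ^ k) (n := 2 ^ k) fun j hj => by
      refine h01.mono_set ?_
      have hj1 : ((j : ℝ) + 1) / 2 ^ k ≤ 1 := by
        rw [div_le_one (by positivity)]
        exact_mod_cast hj
      push_cast
      rw [uIcc_of_le (hle j), uIcc_of_le zero_le_one]
      exact Icc_subset_Icc (by positivity) hj1
  simp only [Nat.cast_zero, zero_div, Nat.cast_pow, Nat.cast_ofNat, Nat.cast_add, Nat.cast_one]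
    at h
  rw [div_self (by positivity), intervalIntegral.integral_of_le zero_le_one,
    ← integral_Ico_eq_integral_Ioc] at h
  rw [← h]
  refine Finset.sum_congr rfl fun j _ => ?_
  rw [intervalIntegral.integral_of_le (hle j), integral_Ico_eq_integral_Ioc]

theorem Ico_dyadic_subset {k j : ℕ} (hj : j < 2 ^ k) :
    Ico ((j : ℝ) / 2 ^ k) ((j + 1) / 2 ^ k) ⊆ Ico 0 1 := by
  rw [← setOf_dyadicIndex_eq_inter_Ico hj]
  exact inter_subset_right

theorem volume_real_Ico_dyadic (k j : ℕ) :
    volume.real (Ico ((j : ℝ) / 2 ^ k) ((j + 1) / 2 ^ k)) = (2 ^ k)⁻¹ := by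
  rw [Real.volume_real_Ico_of_le (by gcongr; simp)]
  ring

theorem comparisonRate_div_le_bitRate {t : ℝ} (ht : 0 ≤ t) (k : ℕ) :
    comparisonRate (t / 2 ^ k) ≤ bitRate t :=
  (summable_comparisonRate ht).le_tsum k fun _ _ => comparisonRate_nonneg (by positivity)

theorem measurable_comparisonRate : Measurable comparisonRate :=
  continuous_poissonComparisons.measurable.div measurable_id

variable {f : ℝ → ℝ}

theorem integrableOn_mul_comparisonRate (hf : Measurable f) (hf0 : 0 ≤ f) {lam : ℝ}
    (hlam : 0 ≤ lam)
    (hint : IntegrableOn (fun x => lam * f x * bitRate (lam * f x)) (Ico 0 1)) (k : ℕ) :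
    IntegrableOn (fun x => lam * f x * comparisonRate (lam * f x / 2 ^ k)) (Ico 0 1) := by
  refine Integrable.mono' hint ?_ (ae_of_all _ fun x => ?_)
  · exact ((hf.const_mul lam).mul
      (measurable_comparisonRate.comp ((hf.const_mul lam).div_const _))).aestronglyMeasurable
  · have h0 : 0 ≤ lam * f x := mul_nonneg hlam (hf0 x)
    rw [Real.norm_of_nonneg (mul_nonneg h0 (comparisonRate_nonneg (by positivity)))]
    exact mul_le_mul_of_nonneg_left (comparisonRate_div_le_bitRate h0 k) h0

/-- The mass of a cell of rank k is the average of f / 2^k over it, so Jensen bounds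
`poissonComparisons` of the scaled mass by its average over the cell. -/
theorem levelComparisons_densityDist_le (hf : Measurable f) (hf0 : 0 ≤ f)
    (hfi : IntegrableOn f (Ico 0 1)) {lam : ℝ} (hlam : 0 ≤ lam)
    (hint : IntegrableOn (fun x => lam * f x * bitRate (lam * f x)) (Ico 0 1)) (k : ℕ) :
    levelComparisons (densityDist f) lam k ≤
      ∫ x in Ico 0 1, lam * f x * comparisonRate (lam * f x / 2 ^ k) := by
  have hk := integrableOn_mul_comparisonRate hf hf0 hlam hint k
  rw [← sum_setIntegral_dyadic hk k, levelComparisons]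
  refine Finset.sum_le_sum fun j hj => ?_
  have hj := Finset.mem_range.1 hj
  have hpt : ∀ x, lam * f x * comparisonRate (lam * f x / 2 ^ k) =
      2 ^ k * poissonComparisons (lam / 2 ^ k * f x) := by
    intro x
    rw [← mul_comparisonRate, ← mul_div_right_comm]
    field_simp
  simp only [hpt] at hk ⊢
  have hg : IntegrableOn (fun x => poissonComparisons (lam / 2 ^ k * f x)) (Ico 0 1) := by
    have := hk.const_mul ((2 : ℝ) ^ k)⁻¹
    simpa [IntegrableOn] using this
  have hJ := ConvexOn.map_set_average_le (μ := volume)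
    (t := Ico ((j : ℝ) / 2 ^ k) ((j + 1) / 2 ^ k)) (f := f)
    (convexOn_poissonComparisons_mul (lam / 2 ^ k))
    (continuous_poissonComparisons.comp (continuous_const_mul _)).continuousOn isClosed_univ
    (by simp [div_lt_div_iff_of_pos_right]) (by simp) (by simp)
    (hfi.mono_set (Ico_dyadic_subset hj)) (hg.mono_set (Ico_dyadic_subset hj))
  rw [setAverage_eq, setAverage_eq, volume_real_Ico_dyadic, inv_inv, smul_eq_mul, smul_eq_mul,
    ← mul_assoc, div_mul_cancel₀ _ (by positivity), ← cellMass_densityDist hf hf0 hj] at hJ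
  rwa [integral_const_mul]

theorem meanBits_densityDist_le (hf : Measurable f) (hf0 : 0 ≤ f)
    (hf1 : ∫⁻ x in Ioo (0 : ℝ) 1, ENNReal.ofReal (f x) = 1)
    (hfi : IntegrableOn f (Ico 0 1)) (lam : ℝ≥0)
    (hint : IntegrableOn (fun x => lam * f x * bitRate (lam * f x)) (Ico 0 1)) :
    meanBits (densityDist f) lam ≤
      ENNReal.ofReal (∫ x in Ico 0 1, lam * f x * bitRate (lam * f x)) := by
  have := isProbabilityMeasure_densityDist hf1
  have h0 : ∀ x, 0 ≤ lam * f x := fun x => mul_nonneg lam.coe_nonneg (hf0 x)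
  rw [meanBits_eq_tsum_levelComparisons _ (ae_mem_Ico_densityDist f),
    ofReal_integral_eq_lintegral_ofReal hint
      (ae_of_all _ fun x => mul_nonneg (h0 x) (bitRate_nonneg (h0 x)))]
  simp_rw [fun x => ofReal_mul_bitRate (h0 x)]
  have hm : ∀ k : ℕ, Measurable fun x => lam * f x * comparisonRate (lam * f x / 2 ^ k) := fun k =>
    (hf.const_mul _).mul (measurable_comparisonRate.comp ((hf.const_mul _).div_const _))
  rw [lintegral_tsum fun k => (hm k).ennreal_ofReal.aemeasurable]
  refine ENNReal.tsum_le_tsum fun k => ?_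
  rw [← ofReal_integral_eq_lintegral_ofReal
    (integrableOn_mul_comparisonRate hf hf0 lam.coe_nonneg hint k)
    (ae_of_all _ fun x => mul_nonneg (h0 x) (comparisonRate_nonneg (div_nonneg (h0 x)
      (by positivity))))]
  exact ENNReal.ofReal_le_ofReal (levelComparisons_densityDist_le hf hf0 hfi lam.coe_nonneg hint k)

/-- A dominating function for the normalized increments of `u * bitRate (u * x)`. -/
noncomputable def logDominator (u : ℝ) : ℝ := u * (4 + 6 * |Real.log u| + 4 * Real.posLog u ^ 2)

theorem logDominator_nonneg {u : ℝ} (hu : 0 ≤ u) : 0 ≤ logDominator u := by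
  unfold logDominator
  positivity

theorem mul_abs_log_le {u : ℝ} (hu : 0 ≤ u) : u * |Real.log u| ≤ 1 + u * Real.posLog u := by
  rcases le_total 1 u with h1 | h1
  · rw [abs_of_nonneg (Real.log_nonneg h1), Real.posLog_eq_log (by rwa [abs_of_nonneg hu])]
    linarith
  · have h2 : 0 ≤ u * Real.posLog u := mul_nonneg hu Real.posLog_nonneg
    rcases hu.eq_or_lt with rfl | hu0
    · simp
    · have := (Real.abs_log_mul_self_lt u hu0 h1).le
      rw [abs_mul, abs_of_pos hu0, mul_comm] at this
      linarith

/-- The domination involves only u log₊² u, which the fourth power controls through p² ≤ 1 + p⁴; the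
part of |log u| from u < 1 is harmless because u |log u| is bounded there. -/
theorem logDominator_le {u : ℝ} (hu : 0 ≤ u) :
    logDominator u ≤ 6 + 14 * u + 10 * (u * Real.posLog u ^ 4) := by
  have h1 := mul_abs_log_le hu
  have hp : (0 : ℝ) ≤ Real.posLog u := Real.posLog_nonneg
  have h2 : Real.posLog u ≤ 1 + Real.posLog u ^ 4 := by
    nlinarith [sq_nonneg (Real.posLog u ^ 2 - 1), sq_nonneg (Real.posLog u - 1)]
  have h3 : Real.posLog u ^ 2 ≤ 1 + Real.posLog u ^ 4 := by
    nlinarith [sq_nonneg (Real.posLog u ^ 2 - 1), sq_nonneg (Real.posLog u - 1)]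
  have h4 := mul_le_mul_of_nonneg_left h2 hu
  have h5 := mul_le_mul_of_nonneg_left h3 hu
  have h6 : logDominator u =
      4 * u + 6 * (u * |Real.log u|) + 4 * (u * Real.posLog u ^ 2) := by
    rw [logDominator]
    ring
  linarith

theorem measurable_posLog : Measurable Real.posLog := by
  unfold Real.posLog
  fun_prop

theorem measurable_logDominator : Measurable logDominator := by
  have := measurable_posLog
  unfold logDominator
  fun_prop

theorem integrableOn_logDominator (hf : Measurable f) (hf0 : 0 ≤ f)
    (hfi : IntegrableOn f (Ico 0 1))
    (hlog : IntegrableOn (fun x => f x * Real.posLog (f x) ^ 4) (Ico 0 1)) :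
    IntegrableOn (fun x => logDominator (f x)) (Ico 0 1) := by
  have hc : IntegrableOn (fun _ : ℝ => (6 : ℝ)) (Ico 0 1) := by simp
  refine Integrable.mono' ((hc.add (hfi.const_mul 14)).add (hlog.const_mul 10))
    (measurable_logDominator.comp hf).aestronglyMeasurable (ae_of_all _ fun x => ?_)
  rw [Real.norm_of_nonneg (logDominator_nonneg (hf0 x))]
  exact logDominator_le (hf0 x)

theorem abs_mul_logb_le {u : ℝ} (hu : 0 ≤ u) : |u * Real.logb 2 u| ≤ logDominator u := by
  have hl2 : 1 / Real.log 2 ≤ 2 := by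
    rw [div_le_iff₀ (Real.log_pos one_lt_two)]
    linarith [Real.log_two_gt_d9]
  rw [abs_mul, abs_of_nonneg hu, logDominator, Real.logb, div_eq_mul_one_div, abs_mul,
    abs_of_nonneg (a := 1 / Real.log 2) (by positivity)]
  have h1 := mul_le_mul_of_nonneg_left hl2 (abs_nonneg (Real.log u))
  have h2 : 0 ≤ Real.posLog u ^ 2 := sq_nonneg _
  exact mul_le_mul_of_nonneg_left (by linarith [abs_nonneg (Real.log u)]) hu

theorem measurable_mul_logb : Measurable fun u : ℝ => u * Real.logb 2 u := by
  unfold Real.logb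
  fun_prop

theorem integrableOn_mul_logb (hf : Measurable f) (hf0 : 0 ≤ f)
    (hdom : IntegrableOn (fun x => logDominator (f x)) (Ico 0 1)) :
    IntegrableOn (fun x => f x * Real.logb 2 (f x)) (Ico 0 1) :=
  Integrable.mono' hdom (measurable_mul_logb.comp hf).aestronglyMeasurable
    (ae_of_all _ fun x => abs_mul_logb_le (hf0 x))

theorem abs_mul_bitRate_sub_le {u x : ℝ} (hu : 0 ≤ u) (hx : Real.exp 1 ≤ x) :
    |u * (bitRate (u * x) - bitRate x)| ≤ Real.log x * logDominator u := by
  rcases hu.eq_or_lt with rfl | hu0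
  · simp [logDominator]
  · rw [abs_mul, abs_of_pos hu0, logDominator, mul_left_comm]
    exact mul_le_mul_of_nonneg_left (abs_bitRate_mul_sub_le hu0 hx) hu

theorem integrableOn_mul_bitRate (hf : Measurable f) (hf0 : 0 ≤ f)
    (hfi : IntegrableOn f (Ico 0 1))
    (hdom : IntegrableOn (fun x => logDominator (f x)) (Ico 0 1)) {lam : ℝ} (hlam : 0 ≤ lam) :
    IntegrableOn (fun x => lam * f x * bitRate (lam * f x)) (Ico 0 1) := by
  -- The increment bound requires a base point of at least e; monotonicity of `bitRate` allows λ to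
  -- be raised to it.
  set y := max lam (Real.exp 1)
  refine Integrable.mono' (((hfi.mul_const (bitRate y)).add (hdom.const_mul (Real.log y))).const_mul
    lam) ((hf.const_mul _).mul (measurable_bitRate.comp (hf.const_mul _))).aestronglyMeasurable
    (ae_of_all _ fun x => ?_)
  have h0 : 0 ≤ lam * f x := mul_nonneg hlam (hf0 x)
  have hy : lam ≤ y := le_max_left _ _
  have hm : bitRate (lam * f x) ≤ bitRate (f x * y) := by
    rw [mul_comm lam]
    exact monotoneOn_bitRate (mem_Ici.2 (mul_nonneg (hf0 x) hlam))
      (mem_Ici.2 (mul_nonneg (hf0 x) (hlam.trans hy))) (mul_le_mul_of_nonneg_left hy (hf0 x))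
  have h1 := (le_abs_self _).trans (abs_mul_bitRate_sub_le (hf0 x) (le_max_right lam (Real.exp 1)))
  have h2 := mul_le_mul_of_nonneg_left hm (hf0 x)
  rw [Real.norm_of_nonneg (mul_nonneg h0 (bitRate_nonneg h0)), mul_assoc]
  refine mul_le_mul_of_nonneg_left ?_ hlam
  simp only [Pi.add_apply]
  rw [mul_sub] at h1
  linarith

theorem tendsto_integral_bitRate_sub_div_log (hf : Measurable f) (hf0 : 0 ≤ f)
    (hdom : IntegrableOn (fun x => logDominator (f x)) (Ico 0 1)) :
    Tendsto (fun lam => ∫ x in Ico 0 1, f x * (bitRate (f x * lam) - bitRate lam) / Real.log lam)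
      atTop (nhds (∫ x in Ico 0 1, 2 * (f x * Real.logb 2 (f x)))) := by
  refine tendsto_integral_filter_of_dominated_convergence (fun x => logDominator (f x))
    (Eventually.of_forall fun lam => ?_) ?_ hdom (ae_of_all _ fun x => ?_)
  · exact ((hf.mul ((measurable_bitRate.comp (hf.mul_const _)).sub_const _)).div_const
      _).aestronglyMeasurable
  · filter_upwards [eventually_ge_atTop (Real.exp 1)] with lam hlam
    refine ae_of_all _ fun x => ?_
    have hlog : 0 < Real.log lam :=
      Real.log_pos ((Real.one_lt_exp_iff.2 one_pos).trans_le hlam)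
    rw [norm_div, Real.norm_of_nonneg hlog.le, div_le_iff₀ hlog, mul_comm (logDominator _)]
    exact abs_mul_bitRate_sub_le (hf0 x) hlam
  · rcases (hf0 x).eq_or_lt with h | h
    · simp [← h]
    · have := (tendsto_bitRate_mul_sub_div_log h).const_mul (f x)
      simp_rw [mul_div_assoc]
      rwa [mul_left_comm] at this

end UpperBound

/-! ### Lower bound: entropies of cell averages -/

section LowerBound

variable {f : ℝ → ℝ}

/-- This is Lebesgue differentiation along balls that contain x without being centred at it: up to
an endpoint, a cell is the closed ball of radius 2^(-k-1) about its midpoint. -/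
theorem ae_tendsto_cellMass (hf : Measurable f) (hf0 : 0 ≤ f) (hfi : Integrable f) :
    ∀ᵐ x, x ∈ Ico (0 : ℝ) 1 → Tendsto
      (fun k => 2 ^ k * cellMass (densityDist f) k (dyadicIndex k x)) atTop (nhds (f x)) := by
  filter_upwards [IsUnifLocDoublingMeasure.ae_tendsto_average (μ := volume)
    hfi.locallyIntegrable 1] with x hx h01
  have hδ : Tendsto (fun k : ℕ => (1 / 2 : ℝ) ^ k * (1 / 2)) atTop (nhdsWithin 0 (Ioi 0)) := by
    refine tendsto_nhdsWithin_iff.2 ⟨?_, Eventually.of_forall fun k => mem_Ioi.2 (by positivity)⟩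
    have := (tendsto_pow_atTop_nhds_zero_of_lt_one (r := (1 / 2 : ℝ)) (by norm_num)
      (by norm_num)).mul_const (1 / 2)
    simpa using this
  have hball : ∀ k : ℕ, Metric.closedBall (((dyadicIndex k x : ℝ) + 1 / 2) / 2 ^ k)
      ((1 / 2 : ℝ) ^ k * (1 / 2)) =
      Icc ((dyadicIndex k x : ℝ) / 2 ^ k) ((dyadicIndex k x + 1) / 2 ^ k) := by
    intro k
    rw [Real.closedBall_eq_Icc]
    congr 1
    · rw [one_div_pow]
      ring
    · rw [one_div_pow]
      ring
  refine (hx (fun k => ((dyadicIndex k x : ℝ) + 1 / 2) / 2 ^ k) _ hδ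
    (Eventually.of_forall fun k => ?_)).congr fun k => ?_
  · rw [one_mul, hball]
    exact Ico_subset_Icc_self ((dyadicIndex_eq_iff h01.1 k _).1 rfl)
  · rw [hball, setAverage_congr Ico_ae_eq_Icc.symm, setAverage_eq, volume_real_Ico_dyadic, inv_inv,
      smul_eq_mul, cellMass_densityDist hf hf0 (dyadicIndex_lt h01 k)]

theorem integral_comp_dyadicIndex (a : ℕ → ℝ) (k : ℕ) :
    IntegrableOn (fun x => a (dyadicIndex k x)) (Ico 0 1) ∧
      ∫ x in Ico 0 1, a (dyadicIndex k x) = ∑ j ∈ Finset.range (2 ^ k), (2 ^ k)⁻¹ * a j := by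
  have hint : IntegrableOn (fun x => a (dyadicIndex k x)) (Ico 0 1) := by
    refine Measure.integrableOn_of_bounded (M := ∑ j ∈ Finset.range (2 ^ k), |a j|) (by simp)
      ((measurable_from_nat (f := a)).comp (measurable_dyadicIndex k)).aestronglyMeasurable ?_
    filter_upwards [ae_restrict_mem measurableSet_Ico] with x hx
    exact Finset.single_le_sum (f := fun j => |a j|) (fun _ _ => abs_nonneg _)
      (Finset.mem_range.2 (dyadicIndex_lt hx k))
  refine ⟨hint, ?_⟩
  rw [← sum_setIntegral_dyadic hint k]
  refine Finset.sum_congr rfl fun j hj => ?_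
  have hconst : ∀ x ∈ Ico ((j : ℝ) / 2 ^ k) ((j + 1) / 2 ^ k), a (dyadicIndex k x) = a j := by
    intro x hx
    rw [(dyadicIndex_eq_iff (le_trans (by positivity) hx.1) k j).2 hx]
  rw [setIntegral_congr_fun measurableSet_Ico hconst, setIntegral_const, volume_real_Ico_dyadic,
    smul_eq_mul]

/-- The entropy of the conditional expectation of a density given its dyadic cell of rank `k`. -/
noncomputable def cellEntropy (F : Measure ℝ) (k : ℕ) : ℝ :=
  ∑ j ∈ Finset.range (2 ^ k), cellMass F k j * Real.logb 2 (2 ^ k * cellMass F k j)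

/-- Adding 2 makes the entropy integrand nonnegative, which opens the way to Fatou's lemma. -/
theorem neg_two_le_mul_logb {u : ℝ} (hu : 0 ≤ u) : -2 ≤ u * Real.logb 2 u := by
  have hl2 : 1 / Real.log 2 ≤ 2 := by
    rw [div_le_iff₀ (Real.log_pos one_lt_two)]
    linarith [Real.log_two_gt_d9]
  have hl : 0 ≤ 1 / Real.log 2 := by positivity
  have h1 : -1 ≤ u * Real.log u := by
    rcases le_total 1 u with h1 | h1
    · linarith [mul_nonneg hu (Real.log_nonneg h1)]
    · rcases hu.eq_or_lt with rfl | hu0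
      · simp
      · have := (abs_lt.1 (Real.abs_log_mul_self_lt u hu0 h1)).1
        linarith
  have h2 := mul_le_mul_of_nonneg_right h1 hl
  rw [Real.logb, div_eq_mul_one_div, ← mul_assoc]
  linarith

theorem continuous_mul_logb : Continuous fun u : ℝ => u * Real.logb 2 u := by
  have := Real.continuous_mul_log.div_const (Real.log 2)
  simpa only [Real.logb, mul_div_assoc] using this

theorem lintegral_ofReal_add_two {φ : ℝ → ℝ} (hφ : IntegrableOn φ (Ico 0 1)) (h : ∀ x, -2 ≤ φ x) :
    ∫⁻ x in Ico 0 1, ENNReal.ofReal (φ x + 2) =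
      ENNReal.ofReal ((∫ x in Ico 0 1, φ x) + 2) := by
  have hc : IntegrableOn (fun _ : ℝ => (2 : ℝ)) (Ico 0 1) := integrable_const _
  have hi : IntegrableOn (fun x => φ x + 2) (Ico 0 1) := hφ.add hc
  rw [← ofReal_integral_eq_lintegral_ofReal hi (ae_of_all _ fun x => by
    simp only [Pi.zero_apply]
    linarith [h x]), integral_add hφ hc, setIntegral_const]
  simp

theorem cellEntropy_eq_integral (F : Measure ℝ) (k : ℕ) : cellEntropy F k =
    ∫ x in Ico 0 1, 2 ^ k * cellMass F k (dyadicIndex k x) *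
      Real.logb 2 (2 ^ k * cellMass F k (dyadicIndex k x)) := by
  rw [(integral_comp_dyadicIndex
    (fun j => 2 ^ k * cellMass F k j * Real.logb 2 (2 ^ k * cellMass F k j)) k).2]
  refine Finset.sum_congr rfl fun j _ => ?_
  field_simp

/-- The averages over cells converge to f almost everywhere and u lg u is continuous, so Fatou
bounds H(f) by the lower limit of the cell entropies. -/
theorem exists_lt_cellEntropy (hf : Measurable f) (hf0 : 0 ≤ f) (hfi : Integrable f)
    (hent : IntegrableOn (fun x => f x * Real.logb 2 (f x)) (Ico 0 1)) {c : ℝ}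
    (hc : c < ∫ x in Ico 0 1, f x * Real.logb 2 (f x)) :
    ∃ k, c < cellEntropy (densityDist f) k := by
  set ψ : ℝ → ℝ := fun u => u * Real.logb 2 u with hψ
  set a : ℕ → ℕ → ℝ := fun k j => 2 ^ k * cellMass (densityDist f) k j with ha
  have ha0 : ∀ k j, 0 ≤ a k j := fun k j => mul_nonneg (by positivity) (cellMass_nonneg _ _ _)
  have hcell : ∀ k, ∫⁻ x in Ico 0 1, ENNReal.ofReal (ψ (a k (dyadicIndex k x)) + 2) =
      ENNReal.ofReal (cellEntropy (densityDist f) k + 2) := by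
    intro k
    rw [cellEntropy_eq_integral]
    exact lintegral_ofReal_add_two (integral_comp_dyadicIndex (fun j => ψ (a k j)) k).1
      fun x => neg_two_le_mul_logb (ha0 k _)
  have hH : ∫⁻ x in Ico 0 1, ENNReal.ofReal (ψ (f x) + 2) =
      ENNReal.ofReal ((∫ x in Ico 0 1, f x * Real.logb 2 (f x)) + 2) :=
    lintegral_ofReal_add_two hent fun x => neg_two_le_mul_logb (hf0 x)
  have hlim : ∀ᵐ x ∂(volume.restrict (Ico (0 : ℝ) 1)), ENNReal.ofReal (ψ (f x) + 2) =
      liminf (fun k => ENNReal.ofReal (ψ (a k (dyadicIndex k x)) + 2)) atTop := by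
    filter_upwards [ae_restrict_mem measurableSet_Ico,
      ae_restrict_of_ae (ae_tendsto_cellMass hf hf0 hfi)] with x hx htend
    refine (Tendsto.liminf_eq ?_).symm
    exact ENNReal.tendsto_ofReal
      (((continuous_mul_logb.tendsto (f x)).comp (htend hx)).add_const 2)
  have hfatou : ENNReal.ofReal ((∫ x in Ico 0 1, f x * Real.logb 2 (f x)) + 2) ≤
      liminf (fun k => ENNReal.ofReal (cellEntropy (densityDist f) k + 2)) atTop := by
    rw [← hH, lintegral_congr_ae hlim]
    refine (lintegral_liminf_le fun k => ?_).trans_eq (by simp_rw [hcell])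
    exact (((measurable_mul_logb.comp (measurable_from_nat (f := a k))).comp
      (measurable_dyadicIndex k)).add_const 2).ennreal_ofReal
  -- If all cell entropies were at most c, this would give c + 2 ≥ 0, so that `ENNReal.ofReal` does
  -- not truncate in the final comparison.
  have hnn : ∀ k, 0 ≤ cellEntropy (densityDist f) k + 2 := by
    intro k
    have h1 := setIntegral_mono (integrable_const (-2 : ℝ))
      (integral_comp_dyadicIndex (fun j => ψ (a k j)) k).1
      fun x => neg_two_le_mul_logb (ha0 k (dyadicIndex k x))
    rw [setIntegral_const] at h1
    rw [cellEntropy_eq_integral]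
    simp only [hψ, ha] at h1
    simp at h1
    linarith
  by_contra! hcon
  have h1 : liminf (fun k => ENNReal.ofReal (cellEntropy (densityDist f) k + 2)) atTop ≤
      ENNReal.ofReal (c + 2) :=
    (liminf_le_liminf (Eventually.of_forall fun k =>
      ENNReal.ofReal_le_ofReal (by linarith [hcon k]))).trans_eq (liminf_const _)
  have h2 := hfatou.trans h1
  rw [ENNReal.ofReal_le_ofReal_iff (by linarith [hnn 0, hcon 0])] at h2
  linarith

theorem sum_cellMass (hf : Measurable f) (hf0 : 0 ≤ f) (hfi : IntegrableOn f (Ico 0 1)) (k : ℕ) :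
    ∑ j ∈ Finset.range (2 ^ k), cellMass (densityDist f) k j = ∫ x in Ico 0 1, f x := by
  rw [← sum_setIntegral_dyadic hfi k]
  exact Finset.sum_congr rfl fun j hj => cellMass_densityDist hf hf0 (Finset.mem_range.1 hj)

/-- Both terms are compared with R(λ). As the masses sum to 1, the K gained from 2^(-K) joins the
logarithms: lg p + K = lg(2^K p). -/
theorem tendsto_sum_cellMass_mul_bitRate (F : Measure ℝ) (K : ℕ)
    (hsum : ∑ j ∈ Finset.range (2 ^ K), cellMass F K j = 1) :
    Tendsto (fun lam => (∑ j ∈ Finset.range (2 ^ K), cellMass F K j *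
      bitRate (cellMass F K j * lam) - bitRate ((2 ^ K)⁻¹ * lam)) / Real.log lam) atTop
      (nhds (2 * cellEntropy F K)) := by
  have h1 : Tendsto (fun lam => ∑ j ∈ Finset.range (2 ^ K), cellMass F K j *
      ((bitRate (cellMass F K j * lam) - bitRate lam) / Real.log lam)) atTop
      (nhds (∑ j ∈ Finset.range (2 ^ K), cellMass F K j *
        (2 * Real.logb 2 (cellMass F K j)))) := by
    refine tendsto_finsetSum _ fun j _ => ?_
    rcases (cellMass_nonneg F K j).eq_or_lt with h | h
    · simp [← h]
    · exact (tendsto_bitRate_mul_sub_div_log h).const_mul _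
  have h2 := tendsto_bitRate_mul_sub_div_log (u := ((2 : ℝ) ^ K)⁻¹) (by positivity)
  have h3 : ∑ j ∈ Finset.range (2 ^ K), cellMass F K j * (2 * Real.logb 2 (cellMass F K j)) -
      2 * Real.logb 2 (((2 : ℝ) ^ K)⁻¹) = 2 * cellEntropy F K := by
    have h4 : Real.logb 2 (((2 : ℝ) ^ K)⁻¹) = -K := by
      rw [Real.logb_inv, Real.logb_pow, Real.logb_self_eq_one one_lt_two, mul_one]
    rw [h4, ← mul_one (-(K : ℝ)), ← hsum, Finset.mul_sum, cellEntropy, Finset.mul_sum,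
      Finset.mul_sum, ← Finset.sum_sub_distrib]
    refine Finset.sum_congr rfl fun j _ => ?_
    rcases (cellMass_nonneg F K j).eq_or_lt with h | h
    · simp [← h]
    · rw [Real.logb_mul (by positivity) h.ne', Real.logb_pow, Real.logb_self_eq_one one_lt_two]
      ring
  rw [← h3]
  refine (h1.sub h2).congr fun lam => ?_
  have h5 : ∑ j ∈ Finset.range (2 ^ K), cellMass F K j *
      ((bitRate (cellMass F K j * lam) - bitRate lam) / Real.log lam) =
      (∑ j ∈ Finset.range (2 ^ K), cellMass F K j * bitRate (cellMass F K j * lam) -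
        bitRate lam) / Real.log lam := by
    conv_rhs => rw [← one_mul (bitRate lam), ← hsum, Finset.sum_mul, ← Finset.sum_sub_distrib,
      Finset.sum_div]
    refine Finset.sum_congr rfl fun j _ => ?_
    ring
  rw [h5]
  ring

end LowerBound

/-! ### The limit and the main theorem -/

section Asymptotics

variable {f : ℝ → ℝ}

theorem summable_levelComparisons (F : Measure ℝ) [IsProbabilityMeasure F] [NullSingletonClass F]
    (hF : ∀ᵐ x ∂F, x ∈ Ico (0 : ℝ) 1) {lam : ℝ≥0} (h : meanBits F lam < ∞) :
    Summable (levelComparisons F lam) ∧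
      (meanBits F lam).toReal = ∑' k, levelComparisons F lam k := by
  rw [meanBits_eq_tsum_levelComparisons F hF] at h ⊢
  have hr : ∀ k, (ENNReal.ofReal (levelComparisons F lam k)).toReal = levelComparisons F lam k :=
    fun k => ENNReal.toReal_ofReal (levelComparisons_nonneg F lam k)
  constructor
  · simpa only [hr] using ENNReal.summable_toReal h.ne
  · rw [ENNReal.tsum_toReal_eq fun k => ENNReal.ofReal_ne_top]
    simp only [hr]

theorem meanBits_densityDist_lt_top (hf : Measurable f) (hf0 : 0 ≤ f)
    (hf1 : ∫⁻ x in Ioo (0 : ℝ) 1, ENNReal.ofReal (f x) = 1) (hfi : IntegrableOn f (Ico 0 1))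
    (hdom : IntegrableOn (fun x => logDominator (f x)) (Ico 0 1)) (lam : ℝ≥0) :
    meanBits (densityDist f) lam < ∞ :=
  (meanBits_densityDist_le hf hf0 hf1 hfi lam
    (integrableOn_mul_bitRate hf hf0 hfi hdom lam.coe_nonneg)).trans_lt ENNReal.ofReal_lt_top

theorem toReal_meanBits_unifDist (lam : ℝ≥0) :
    (meanBits unifDist lam).toReal = lam * bitRate lam := by
  rw [meanBits_unifDist,
    ENNReal.toReal_ofReal (mul_nonneg lam.coe_nonneg (bitRate_nonneg lam.coe_nonneg))]

/-- The two bounds are checked separately against an arbitrary c on either side of the limit, so K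
may depend on c but not on λ. -/
theorem tendsto_toReal_meanBits_sub_div (hf : Measurable f) (hf0 : 0 ≤ f)
    (hf1 : ∫⁻ x in Ioo (0 : ℝ) 1, ENNReal.ofReal (f x) = 1) (hfi : Integrable f)
    (hdom : IntegrableOn (fun x => logDominator (f x)) (Ico 0 1)) :
    Tendsto (fun lam : ℝ≥0 => ((meanBits (densityDist f) lam).toReal -
        (meanBits unifDist lam).toReal) / (lam * Real.log lam)) atTop
      (nhds (2 * ∫ x in Ico 0 1, f x * Real.logb 2 (f x))) := by
  have := isProbabilityMeasure_densityDist hf1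
  have hF := ae_mem_Ico_densityDist f
  have hfI : IntegrableOn f (Ico 0 1) := hfi.integrableOn
  have hone : ∫ x in Ico 0 1, f x = 1 := by
    rw [integral_Ico_eq_integral_Ioo,
      integral_eq_lintegral_of_nonneg_ae (ae_of_all _ hf0) hf.aestronglyMeasurable, hf1]
    simp
  have hcoe : Tendsto ((↑) : ℝ≥0 → ℝ) atTop atTop := NNReal.tendsto_coe_atTop.2 tendsto_id
  have hlarge : ∀ᶠ lam : ℝ≥0 in atTop, (1 : ℝ) < lam := hcoe.eventually_gt_atTop 1
  refine tendsto_order.2 ⟨fun c hc => ?_, fun c hc => ?_⟩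
  · obtain ⟨K, hK⟩ := exists_lt_cellEntropy hf hf0 hfi (integrableOn_mul_logb hf hf0 hdom)
      (c := c / 2) (by linarith)
    have hlim := (tendsto_sum_cellMass_mul_bitRate (densityDist f) K
      ((sum_cellMass hf hf0 hfI K).trans hone)).comp hcoe
    filter_upwards [hlim.eventually_const_lt (u := c) (by linarith), hlarge] with lam h1 hlam
    obtain ⟨hs, hval⟩ := summable_levelComparisons _ hF
      (meanBits_densityDist_lt_top hf hf0 hf1 hfI hdom lam)
    have hlam0 : (0 : ℝ) < lam := zero_lt_one.trans hlam
    have hlog : 0 < Real.log lam := Real.log_pos hlam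
    -- The term λ R(λ) of this bound cancels against the uniform cost.
    have hle := le_tsum_levelComparisons _ hF hlam0.le hs K
    rw [hval, toReal_meanBits_unifDist]
    refine h1.trans_le ?_
    rw [Function.comp_apply, div_le_div_iff₀ hlog (mul_pos hlam0 hlog), ← mul_assoc]
    refine mul_le_mul_of_nonneg_right ?_ hlog.le
    have h2 : ∑ j ∈ Finset.range (2 ^ K), lam * cellMass (densityDist f) K j *
        bitRate (lam * cellMass (densityDist f) K j) =
        (∑ j ∈ Finset.range (2 ^ K), cellMass (densityDist f) K j *
          bitRate (cellMass (densityDist f) K j * lam)) * lam := by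
      rw [Finset.sum_mul]
      refine Finset.sum_congr rfl fun j _ => ?_
      rw [mul_comm (lam : ℝ)]
      ring
    rw [h2, div_eq_inv_mul] at hle
    linarith
  · have hlim := (tendsto_integral_bitRate_sub_div_log hf hf0 hdom).comp hcoe
    rw [integral_const_mul] at hlim
    filter_upwards [hlim.eventually_lt_const hc, hlarge] with lam h1 hlam
    have hlam0 : (0 : ℝ) < lam := zero_lt_one.trans hlam
    have hlog : 0 < Real.log lam := Real.log_pos hlam
    have hint := integrableOn_mul_bitRate hf hf0 hfI hdom hlam0.le
    have hle := ENNReal.toReal_mono ENNReal.ofReal_ne_top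
      (meanBits_densityDist_le hf hf0 hf1 hfI lam hint)
    rw [ENNReal.toReal_ofReal (integral_nonneg fun x => mul_nonneg (mul_nonneg hlam0.le (hf0 x))
      (bitRate_nonneg (mul_nonneg hlam0.le (hf0 x))))] at hle
    refine lt_of_le_of_lt ?_ h1
    rw [toReal_meanBits_unifDist, Function.comp_apply, integral_div,
      div_le_div_iff₀ (mul_pos hlam0 hlog) hlog, ← mul_assoc]
    refine mul_le_mul_of_nonneg_right ?_ hlog.le
    -- Since f integrates to 1, the uniform cost λ R(λ) can be moved under the integral.
    have h2 : (∫ x in Ico 0 1, f x * (bitRate (f x * lam) - bitRate lam)) * lam =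
        (∫ x in Ico 0 1, lam * f x * bitRate (lam * f x)) - lam * bitRate lam := by
      have h3 : (lam : ℝ) * bitRate lam = ∫ x in Ico 0 1, f x * (lam * bitRate lam) := by
        rw [integral_mul_const, hone, one_mul]
      rw [h3, ← integral_sub hint (hfI.mul_const _), ← integral_mul_const]
      refine integral_congr_ae (ae_of_all _ fun x => ?_)
      simp only [mul_comm (lam : ℝ) (f x)]
      ring
    rw [h2]
    linarith

theorem isLittleO_of_tendsto_sub_div {D : ℝ≥0 → ℝ} {H : ℝ}
    (h : Tendsto (fun lam : ℝ≥0 => D lam / (lam * Real.log lam)) atTop (nhds (2 * H))) :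
    (fun lam : ℝ≥0 => D lam - 2 * H * lam * Real.log lam) =o[atTop]
      fun lam : ℝ≥0 => (lam : ℝ) * Real.log lam := by
  have hlarge : ∀ᶠ lam : ℝ≥0 in atTop, (lam : ℝ) * Real.log lam ≠ 0 := by
    filter_upwards [(NNReal.tendsto_coe_atTop.2 tendsto_id).eventually_gt_atTop (1 : ℝ)]
      with lam hlam
    have hlam1 : (1 : ℝ) < lam := hlam
    exact (mul_pos (zero_lt_one.trans hlam1) (Real.log_pos hlam1)).ne'
  refine (isLittleO_iff_tendsto' (hlarge.mono fun lam h1 h2 => absurd h2 h1)).2 ?_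
  have h0 := h.sub_const (2 * H)
  rw [sub_self] at h0
  refine h0.congr' ?_
  filter_upwards [hlarge] with lam hlam
  rw [sub_div, mul_assoc (2 * H), mul_div_cancel_right₀ _ hlam]

theorem densityDist_congr {g : ℝ → ℝ} (h : EqOn f g (Ioo 0 1)) : densityDist f = densityDist g := by
  refine withDensity_congr_ae ?_
  filter_upwards [ae_restrict_mem measurableSet_Ioo] with x hx
  rw [h hx]

end Asymptotics

theorem theorem1p2 (f : ℝ → ℝ) (hf_meas : Measurable f)
    (hf_nonneg : ∀ x ∈ Ioo (0 : ℝ) 1, 0 ≤ f x)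
    (hf_one : ∫⁻ x in Ioo (0 : ℝ) 1, ENNReal.ofReal (f x) = 1) :
    (∀ lam : ℝ≥0, meanBits unifDist lam ≤ meanBits (densityDist f) lam) ∧
    (IntegrableOn (fun x => f x * Real.posLog (f x) ^ 4) (Ioo 0 1) →
      IntegrableOn (fun x => f x * Real.logb 2 (f x)) (Ioo 0 1) ∧
      0 ≤ entropyBits f ∧
      (∀ lam : ℝ≥0, meanBits unifDist lam < ∞ ∧ meanBits (densityDist f) lam < ∞) ∧
      (fun lam : ℝ≥0 => (meanBits (densityDist f) lam).toReal -
          ((meanBits unifDist lam).toReal + 2 * entropyBits f * lam * Real.log lam))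
        =o[atTop] fun lam : ℝ≥0 => (lam : ℝ) * Real.log lam) := by
  -- The density is prescribed only on (0, 1). Extending it by zero makes it nonnegative and
  -- integrable on the whole line, as Lebesgue differentiation is applied there.
  set g : ℝ → ℝ := (Ioo 0 1).indicator f with hg
  have hgf : EqOn f g (Ioo 0 1) := fun x hx => (indicator_of_mem hx f).symm
  have hg_meas : Measurable g := hf_meas.indicator measurableSet_Ioo
  have hg0 : 0 ≤ g := indicator_nonneg hf_nonneg
  have hg1 : ∫⁻ x in Ioo (0 : ℝ) 1, ENNReal.ofReal (g x) = 1 := by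
    rw [← hf_one]
    exact setLIntegral_congr_fun measurableSet_Ioo fun x hx => by rw [hgf hx]
  have hfi : IntegrableOn f (Ioo 0 1) := by
    refine ⟨hf_meas.aestronglyMeasurable, ?_⟩
    rw [hasFiniteIntegral_iff_ofReal
      ((ae_restrict_mem measurableSet_Ioo).mono fun x hx => hf_nonneg x hx), hf_one]
    exact ENNReal.one_lt_top
  have hgi : Integrable g := (integrable_indicator_iff measurableSet_Ioo).2 hfi
  have := isProbabilityMeasure_densityDist hg1
  rw [densityDist_congr hgf]
  have ha := meanBits_unifDist_le (densityDist g) (ae_mem_Ico_densityDist g)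
  refine ⟨ha, fun hlog => ?_⟩
  have hlog' : IntegrableOn (fun x => g x * Real.posLog (g x) ^ 4) (Ico 0 1) := by
    rw [integrableOn_Ico_iff_integrableOn_Ioo]
    exact hlog.congr_fun (fun x hx => by simp only [hgf hx]) measurableSet_Ioo
  have hdom := integrableOn_logDominator hg_meas hg0 hgi.integrableOn hlog'
  have hent := integrableOn_mul_logb hg_meas hg0 hdom
  have hH : entropyBits f = ∫ x in Ico 0 1, g x * Real.logb 2 (g x) := by
    rw [entropyBits, integral_Ico_eq_integral_Ioo]
    exact setIntegral_congr_fun measurableSet_Ioo fun x hx => by simp only [hgf hx]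
  have hfin := meanBits_densityDist_lt_top hg_meas hg0 hg1 hgi.integrableOn hdom
  have hlim := tendsto_toReal_meanBits_sub_div hg_meas hg0 hg1 hgi hdom
  rw [← hH] at hlim
  refine ⟨?_, ?_, fun lam => ⟨(ha lam).trans_lt (hfin lam), hfin lam⟩, ?_⟩
  · rw [integrableOn_Ico_iff_integrableOn_Ioo] at hent
    exact hent.congr_fun (fun x hx => by simp only [hgf hx]) measurableSet_Ioo
  -- The quotients converging to 2H(f) are nonnegative by part (a).
  · have h0 : 0 ≤ 2 * entropyBits f := by
      refine ge_of_tendsto hlim ?_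
      filter_upwards [eventually_ge_atTop (1 : ℝ≥0)] with lam hlam
      have hlam1 : (1 : ℝ) ≤ lam := by exact_mod_cast hlam
      exact div_nonneg (sub_nonneg.2 (ENNReal.toReal_mono (hfin lam).ne (ha lam)))
        (mul_nonneg (zero_le_one.trans hlam1) (Real.log_nonneg hlam1))
    linarith
  · simpa only [sub_sub] using isLittleO_of_tendsto_sub_div hlim
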